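/- Let $n\ge 1$, let $X$ be a reflexive real Banach space with dual $X^*$, and let $1<p<t<r<\infty$. Write $p'=p/(p-1)$, and similarly $t'$, $r'$. For $j\in\mathbb Z$, $m\in\mathbb Z^n$ let $Q_{j,m}=\prod_{i=1}^n[2^{-j}m_i,2^{-j}(m_i+1))$ be the dyadic cubes of $\mathbb R^n$. All functions are strongly measurable and functions equal almost everywhere are identified. The $X$-valued Bourgain–Morrey space $M_p^{t,r}(X)$ consists of the $f\in L^p_{\rm loc}(\mathbb R^n;X)$ with $$\|f\|_{M_p^{t,r}(X)}=\Big(\sum_{j\in\mathbb Z,\,m\in\mathbb Z^n}\Big[|Q_{j,m}|^{1/t-1/p}\Big(\int_{Q_{j,m}}\|f(x)\|_X^p\,dx\Big)^{1/p}\Big]^r\Big)^{1/r}<\infty .$$ A function $b:\mathbb R^n\to X^*$ is a $(p',t',X^*)$-block supported on a cube $Q$ if it vanishes outside $Q$ and $\big\|\|b\|_{X^*}\big\|_{L^{p'}}\le |Q|^{1/p'-1/t'}=|Q|^{1/t-1/p}$. The block space $\mathcal H_{p'}^{t',r'}(X^*)$ consists of all $g:\mathbb R^n\to X^*$ that can be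 written as $g=\sum_{(j,m)\in\mathbb Z^{1+n}}\lambda_{j,m}b_{j,m}$, converging in $X^*$ almost everywhere on $\mathbb R^n$, with $\lambda\in\ell^{r'}(\mathbb Z^{1+n})$ and $b_{j,m}$ a $(p',t',X^*)$-block supported on $Q_{j,m}$; $\|g\|_{\mathcal H_{p'}^{t',r'}(X^*)}$ is the infimum of $\|\lambda\|_{\ell^{r'}}$ over all such representations. Then the dual of $M_p^{t,r}(X)$ is $\mathcal H_{p'}^{t',r'}(X^*)$, in the following sense. For all $g\in\mathcal H_{p'}^{t',r'}(X^*)$ and $f\in M_p^{t,r}(X)$ the function $x\mapsto\langle f(x),g(x)\rangle$ is integrable on $\mathbb R^n$, and $L_g(f)=\int_{\mathbb R^n}\langle f(x),g(x)\rangle\,dx$ defines a bounded linear functional $L_g$ on $M_p^{t,r}(X)$. Conversely, for every bounded linear functional $L$ on $M_p^{t,r}(X)$ there is a unique $g\in\mathcal H_{p'}^{t',r'}(X^*)$ with $L=L_g$. Moreover, $\|L_g\|=\|g\|_{\mathcal H_{p'}^{t',r'}(X^*)}$ for every $g$, so $g\mapsto L_g$ is an isometric linear isomorphism of $\mathcal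 H_{p'}^{t',r'}(X^*)$ onto $M_p^{t,r}(X)^*$. -/

import Mathlib

open MeasureTheory
open scoped ENNReal

namespace BourgainMorrey

/-- Index set `ℤ × ℤⁿ` of the dyadic cubes of `ℝⁿ`. -/
abbrev CubeIndex (n : ℕ) : Type := ℤ × (Fin n → ℤ)

/-- The dyadic cube `Q_{j,m} = ∏ᵢ [2⁻ʲ mᵢ, 2⁻ʲ (mᵢ + 1))`, for `i = (j, m)`. -/
def cube {n : ℕ} (i : CubeIndex n) : Set (EuclideanSpace ℝ (Fin n)) :=
  {x | ∀ k, (2 : ℝ) ^ (-i.1) * (i.2 k : ℝ) ≤ x k ∧ x k < (2 : ℝ) ^ (-i.1) * ((i.2 k : ℝ) + 1)}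

/-- `‖f‖_{M_p^{t,r}(X)}` as an extended nonnegative real:
the `ℓ^r` norm of `Q ↦ |Q|^{1/t - 1/p} ‖f‖_{L^p(Q)}` over the dyadic cubes `Q`. -/
noncomputable def morreyENorm {n : ℕ} {X : Type*} [NormedAddCommGroup X] (p t r : ℝ)
    (f : EuclideanSpace ℝ (Fin n) → X) : ℝ≥0∞ :=
  (∑' i : CubeIndex n,
    (volume (cube i) ^ (1 / t - 1 / p) *
      eLpNorm f (ENNReal.ofReal p) (volume.restrict (cube i))) ^ r) ^ (1 / r)

/-- `b` is a `(q, s, Y)`-block supported on the set `Q`: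
it vanishes outside `Q` and `‖b‖_{L^q} ≤ |Q|^{1/q - 1/s}`. -/
structure IsBlock {n : ℕ} {Y : Type*} [NormedAddCommGroup Y] (q s : ℝ)
    (Q : Set (EuclideanSpace ℝ (Fin n))) (b : EuclideanSpace ℝ (Fin n) → Y) : Prop where
  aestronglyMeasurable : AEStronglyMeasurable b volume
  support : ∀ x, x ∉ Q → b x = 0
  eLpNorm_le : eLpNorm b (ENNReal.ofReal q) volume ≤ volume Q ^ (1 / q - 1 / s)

/-- `f = ∑_Q λ_Q b_Q`, converging in `Y` almost everywhere, with `λ ∈ ℓ^u` and `b_Q` a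
`(q, s, Y)`-block supported on the dyadic cube `Q`. -/
structure IsDecomposition {n : ℕ} {Y : Type*} [NormedAddCommGroup Y] [NormedSpace ℝ Y]
    (q s u : ℝ) (f : EuclideanSpace ℝ (Fin n) → Y) (l : CubeIndex n → ℝ)
    (b : CubeIndex n → EuclideanSpace ℝ (Fin n) → Y) : Prop where
  summable : Summable fun i => |l i| ^ u
  isBlock : ∀ i, IsBlock q s (cube i) (b i)
  hasSum : ∀ᵐ x ∂(volume : Measure (EuclideanSpace ℝ (Fin n))), HasSum (fun i => l i • b i x) (f x)

/-- The values `‖λ‖_{ℓ^u}` over all block decompositions of `f`. -/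
def blockNormSet {n : ℕ} {Y : Type*} [NormedAddCommGroup Y] [NormedSpace ℝ Y]
    (q s u : ℝ) (f : EuclideanSpace ℝ (Fin n) → Y) : Set ℝ :=
  {N | ∃ l b, IsDecomposition q s u f l b ∧ N = (∑' i, |l i| ^ u) ^ (1 / u)}

/-! ### The Bourgain-Morrey space as a normed space -/

section Morrey

variable {n : ℕ} {X : Type*} [NormedAddCommGroup X]

lemma morreyENorm_congr {p t r : ℝ} {f g : EuclideanSpace ℝ (Fin n) → X} (h : f =ᵐ[volume] g) :
    morreyENorm p t r f = morreyENorm p t r g := by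
  unfold morreyENorm
  congr 1
  refine tsum_congr fun i => ?_
  rw [eLpNorm_congr_ae (ae_restrict_of_ae h)]

lemma tsum_minkowski {ι : Type*} [Countable ι] {r : ℝ} (hr : 1 ≤ r) (a b : ι → ℝ≥0∞) :
    (∑' i, (a i + b i) ^ r) ^ (1 / r) ≤ (∑' i, a i ^ r) ^ (1 / r) + (∑' i, b i ^ r) ^ (1 / r) := by
  let _ : MeasurableSpace ι := ⊤
  have h := ENNReal.lintegral_Lp_add_le (μ := Measure.count) (f := a) (g := b)
    (Measurable.of_discrete.aemeasurable) (Measurable.of_discrete.aemeasurable) hr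
  simpa [lintegral_count] using h

lemma morreyENorm_add_le {p t r : ℝ} (hp : 1 < p) (hr : 1 < r)
    {f g : EuclideanSpace ℝ (Fin n) → X}
    (hf : AEStronglyMeasurable f volume) (hg : AEStronglyMeasurable g volume) :
    morreyENorm p t r (f + g) ≤ morreyENorm p t r f + morreyENorm p t r g := by
  refine le_trans ?_ (tsum_minkowski hr.le _ _)
  unfold morreyENorm
  have hr0 : 0 < r := by linarith
  refine ENNReal.rpow_le_rpow ?_ (by positivity)
  refine ENNReal.tsum_le_tsum fun i => ENNReal.rpow_le_rpow ?_ hr0.le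
  rw [← mul_add]
  gcongr
  exact eLpNorm_add_le hf.restrict hg.restrict (by simpa using hp.le)

lemma morreyENorm_const_smul [NormedSpace ℝ X] {p t r : ℝ} (hr : 1 < r) (c : ℝ)
    (f : EuclideanSpace ℝ (Fin n) → X) :
    morreyENorm p t r (c • f) = ‖c‖ₑ * morreyENorm p t r f := by
  have hr0 : 0 < r := by linarith
  unfold morreyENorm
  simp_rw [eLpNorm_const_smul, mul_left_comm _ ‖c‖ₑ, ENNReal.mul_rpow_of_nonneg _ _ hr0.le]
  rw [ENNReal.tsum_mul_left, ENNReal.mul_rpow_of_nonneg _ _ (by positivity), ← ENNReal.rpow_mul,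
    mul_one_div_cancel hr0.ne', ENNReal.rpow_one]

lemma morreyENorm_zero {p t r : ℝ} (hr : 1 < r) :
    morreyENorm p t r (0 : EuclideanSpace ℝ (Fin n) → X) = 0 := by
  have hr0 : 0 < r := by linarith
  simp [morreyENorm, hr0]

lemma cube_eq_preimage (i : CubeIndex n) :
    cube i = WithLp.ofLp ⁻¹' (Set.univ.pi fun k =>
      Set.Ico ((2 : ℝ) ^ (-i.1) * (i.2 k : ℝ)) ((2 : ℝ) ^ (-i.1) * ((i.2 k : ℝ) + 1))) := by
  ext x
  simp [cube]

lemma volume_cube (i : CubeIndex n) :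
    volume (cube i) = ENNReal.ofReal ((2 : ℝ) ^ (-i.1)) ^ n := by
  rw [cube_eq_preimage, (PiLp.volume_preserving_ofLp (Fin n)).measure_preimage
    (MeasurableSet.univ_pi fun _ => measurableSet_Ico).nullMeasurableSet, volume_pi_pi]
  simp only [Real.volume_Ico]
  rw [Finset.prod_congr rfl (g := fun _ => ENNReal.ofReal ((2 : ℝ) ^ (-i.1)))
    (fun k _ => by congr 1; ring)]
  simp

lemma iUnion_unit_cube : (⋃ m : Fin n → ℤ, cube ((0 : ℤ), m)) = Set.univ := by
  refine Set.eq_univ_of_forall fun x => Set.mem_iUnion.2 ⟨fun k => ⌊x k⌋, fun k => ?_⟩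
  simp [Int.floor_le, Int.lt_floor_add_one]

lemma ae_eq_zero_of_morreyENorm_eq_zero {p t r : ℝ} (hp : 1 < p) (hr : 1 < r)
    {f : EuclideanSpace ℝ (Fin n) → X} (hf : AEStronglyMeasurable f volume)
    (h : morreyENorm p t r f = 0) : f =ᵐ[volume] 0 := by
  have hr0 : 0 < r := by linarith
  have h1 : ∀ i : CubeIndex n, f =ᵐ[volume.restrict (cube i)] 0 := by
    intro i
    rw [morreyENorm, ENNReal.rpow_eq_zero_iff_of_pos (by positivity), ENNReal.tsum_eq_zero] at h
    have hi := h i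
    rw [ENNReal.rpow_eq_zero_iff_of_pos hr0, mul_eq_zero] at hi
    rcases hi with hi | hi
    · rw [volume_cube, ENNReal.rpow_eq_zero_iff] at hi
      exfalso
      rcases hi with hi | hi
      · have : (0 : ℝ) < 2 ^ (-i.1) := by positivity
        exact pow_ne_zero n (by simpa using this) hi.1
      · exact ENNReal.pow_ne_top ENNReal.ofReal_ne_top hi.1
    · exact (eLpNorm_eq_zero_iff hf.restrict (by simp; linarith)).1 hi
  have h2 : f =ᵐ[volume.restrict (⋃ m : Fin n → ℤ, cube ((0 : ℤ), m))] 0 :=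
    (ae_restrict_iUnion_iff _ _).2 fun m => h1 (0, m)
  rwa [iUnion_unit_cube, Measure.restrict_univ] at h2

variable [NormedSpace ℝ X]

variable (n X) in
/-- The `X`-valued Bourgain-Morrey space `M_p^{t,r}(X)` on `ℝⁿ`: classes of strongly measurable
functions of finite norm. (A finite norm forces local `p`-integrability, as every compact set lies
in finitely many cubes `Q_{0,m}`.) -/
def MorreySpace (p t r : ℝ) [hp : Fact (1 < p)] [hr : Fact (1 < r)] :
    Submodule ℝ (EuclideanSpace ℝ (Fin n) →ₘ[volume] X) where
  carrier := {f | morreyENorm p t r f < ∞}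
  add_mem' {f g} hf hg := by
    change morreyENorm p t r _ < ∞
    rw [morreyENorm_congr (AEEqFun.coeFn_add f g)]
    exact (morreyENorm_add_le hp.out hr.out f.aestronglyMeasurable g.aestronglyMeasurable).trans_lt
      (ENNReal.add_lt_top.2 ⟨hf, hg⟩)
  zero_mem' := by
    change morreyENorm p t r _ < ∞
    rw [morreyENorm_congr AEEqFun.coeFn_zero, morreyENorm_zero hr.out]
    exact ENNReal.zero_lt_top
  smul_mem' c f hf := by
    change morreyENorm p t r _ < ∞
    rw [morreyENorm_congr (AEEqFun.coeFn_smul c f), morreyENorm_const_smul hr.out]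
    exact ENNReal.mul_lt_top enorm_lt_top hf

noncomputable instance (p t r : ℝ) [Fact (1 < p)] [Fact (1 < r)] :
    Norm (MorreySpace n X p t r) where
  norm f := (morreyENorm p t r (f : EuclideanSpace ℝ (Fin n) →ₘ[volume] X)).toReal

lemma MorreySpace.core (p t r : ℝ) [hp : Fact (1 < p)] [hr : Fact (1 < r)] :
    NormedSpace.Core ℝ (MorreySpace n X p t r) where
  norm_nonneg _ := ENNReal.toReal_nonneg
  norm_smul c f := by
    change (morreyENorm p t r ((c • (f : EuclideanSpace ℝ (Fin n) →ₘ[volume] X)) :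
      EuclideanSpace ℝ (Fin n) →ₘ[volume] X)).toReal = ‖c‖ * (morreyENorm p t r _).toReal
    rw [morreyENorm_congr (AEEqFun.coeFn_smul c _), morreyENorm_const_smul hr.out,
      ENNReal.toReal_mul, toReal_enorm]
  norm_triangle f g := by
    change (morreyENorm p t r (((f : EuclideanSpace ℝ (Fin n) →ₘ[volume] X) + g) :
      EuclideanSpace ℝ (Fin n) →ₘ[volume] X)).toReal ≤
        (morreyENorm p t r _).toReal + (morreyENorm p t r _).toReal
    rw [morreyENorm_congr (AEEqFun.coeFn_add _ _), ← ENNReal.toReal_add f.2.ne g.2.ne]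
    exact ENNReal.toReal_mono (ENNReal.add_ne_top.2 ⟨f.2.ne, g.2.ne⟩)
      (morreyENorm_add_le hp.out hr.out (AEEqFun.aestronglyMeasurable _)
        (AEEqFun.aestronglyMeasurable _))
  norm_eq_zero_iff f := by
    constructor
    · intro h
      have h0 : morreyENorm p t r (f : EuclideanSpace ℝ (Fin n) →ₘ[volume] X) = 0 :=
        ((ENNReal.toReal_eq_zero_iff _).1 h).resolve_right f.2.ne
      refine Subtype.ext (AEEqFun.ext ?_)
      exact (ae_eq_zero_of_morreyENorm_eq_zero hp.out hr.out (AEEqFun.aestronglyMeasurable _)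
        h0).trans AEEqFun.coeFn_zero.symm
    · rintro rfl
      change (morreyENorm p t r
        ((0 : EuclideanSpace ℝ (Fin n) →ₘ[volume] X) : EuclideanSpace ℝ (Fin n) → X)).toReal = 0
      rw [morreyENorm_congr AEEqFun.coeFn_zero, morreyENorm_zero hr.out, ENNReal.toReal_zero]

noncomputable instance (p t r : ℝ) [Fact (1 < p)] [Fact (1 < r)] :
    NormedAddCommGroup (MorreySpace n X p t r) :=
  NormedAddCommGroup.ofCore (MorreySpace.core p t r)

noncomputable instance (p t r : ℝ) [Fact (1 < p)] [Fact (1 < r)] :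
    NormedSpace ℝ (MorreySpace n X p t r) :=
  NormedSpace.ofCore (MorreySpace.core p t r)

end Morrey

/-! ### The block space as a (semi)normed space -/

section Block

variable {n : ℕ} {Y : Type*} [NormedAddCommGroup Y] [NormedSpace ℝ Y]

lemma IsDecomposition.congr {q s u : ℝ} {f g : EuclideanSpace ℝ (Fin n) → Y}
    {l : CubeIndex n → ℝ} {b : CubeIndex n → EuclideanSpace ℝ (Fin n) → Y}
    (h : IsDecomposition q s u f l b) (hfg : f =ᵐ[volume] g) : IsDecomposition q s u g l b :=
  ⟨h.summable, h.isBlock, by filter_upwards [h.hasSum, hfg] with x hx e; rwa [← e]⟩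

lemma isDecomposition_zero {q s u : ℝ} (hu : 1 < u) :
    IsDecomposition q s u (0 : EuclideanSpace ℝ (Fin n) → Y) 0 0 where
  summable := by
    have : u ≠ 0 := by linarith
    simp [this, summable_zero]
  isBlock i := ⟨aestronglyMeasurable_zero, fun _ _ => rfl, by simp⟩
  hasSum := by
    refine Filter.Eventually.of_forall fun x => ?_
    simp

lemma IsDecomposition.smul {q s u : ℝ} {f : EuclideanSpace ℝ (Fin n) → Y}
    {l : CubeIndex n → ℝ} {b : CubeIndex n → EuclideanSpace ℝ (Fin n) → Y}
    (h : IsDecomposition q s u f l b) (c : ℝ) :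
    IsDecomposition q s u (c • f) (fun i => c * l i) b where
  summable := by
    simp_rw [abs_mul, Real.mul_rpow (abs_nonneg c) (abs_nonneg _)]
    exact h.summable.mul_left _
  isBlock := h.isBlock
  hasSum := by
    filter_upwards [h.hasSum] with x hx
    simpa [mul_smul] using hx.const_smul c

lemma IsBlock.combine {q s : ℝ} (hq : 1 < q) {Q : Set (EuclideanSpace ℝ (Fin n))}
    {b c : EuclideanSpace ℝ (Fin n) → Y} (hb : IsBlock q s Q b) (hc : IsBlock q s Q c) (l m : ℝ) :
    IsBlock q s Q ((|l| + |m|)⁻¹ • (l • b + m • c)) where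
  aestronglyMeasurable :=
    ((hb.aestronglyMeasurable.const_smul l).add (hc.aestronglyMeasurable.const_smul m)).const_smul _
  support x hx := by simp [hb.support x hx, hc.support x hx]
  eLpNorm_le := by
    have h1 : eLpNorm (l • b + m • c) (ENNReal.ofReal q) volume ≤
        ENNReal.ofReal (|l| + |m|) * volume Q ^ (1 / q - 1 / s) := by
      refine (eLpNorm_add_le (hb.aestronglyMeasurable.const_smul l)
        (hc.aestronglyMeasurable.const_smul m) (by simpa using hq.le)).trans ?_
      rw [eLpNorm_const_smul, eLpNorm_const_smul, ENNReal.ofReal_add (abs_nonneg _) (abs_nonneg _),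
        add_mul, Real.enorm_eq_ofReal_abs, Real.enorm_eq_ofReal_abs]
      gcongr
      · exact hb.eLpNorm_le
      · exact hc.eLpNorm_le
    rw [eLpNorm_const_smul]
    calc ‖(|l| + |m|)⁻¹‖ₑ * eLpNorm (l • b + m • c) (ENNReal.ofReal q) volume
        ≤ ‖(|l| + |m|)⁻¹‖ₑ * (ENNReal.ofReal (|l| + |m|) * volume Q ^ (1 / q - 1 / s)) := by gcongr
      _ = ENNReal.ofReal ((|l| + |m|)⁻¹ * (|l| + |m|)) * volume Q ^ (1 / q - 1 / s) := by
          rw [Real.enorm_eq_ofReal (by positivity), ENNReal.ofReal_mul (by positivity), mul_assoc]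
      _ ≤ 1 * volume Q ^ (1 / q - 1 / s) := by
          gcongr
          rw [ENNReal.ofReal_le_one]
          exact inv_mul_le_one
      _ = _ := one_mul _

lemma IsDecomposition.add {q s u : ℝ} (hq : 1 < q) (hu : 1 < u)
    {f g : EuclideanSpace ℝ (Fin n) → Y} {l m : CubeIndex n → ℝ}
    {b c : CubeIndex n → EuclideanSpace ℝ (Fin n) → Y}
    (hf : IsDecomposition q s u f l b) (hg : IsDecomposition q s u g m c) :
    IsDecomposition q s u (f + g) (fun i => |l i| + |m i|)
      (fun i => (|l i| + |m i|)⁻¹ • (l i • b i + m i • c i)) where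
  summable := by
    have h := (Real.Lp_add_le_tsum_of_nonneg hu.le (fun i => abs_nonneg (l i))
      (fun i => abs_nonneg (m i)) hf.summable hg.summable).1
    refine h.congr fun i => ?_
    rw [abs_of_nonneg (add_nonneg (abs_nonneg (l i)) (abs_nonneg (m i)))]
  isBlock i := (hf.isBlock i).combine hq (hg.isBlock i) _ _
  hasSum := by
    filter_upwards [hf.hasSum, hg.hasSum] with x hx hy
    have key : (fun i => (|l i| + |m i|) • ((|l i| + |m i|)⁻¹ • (l i • b i + m i • c i)) x) =
        fun i => l i • b i x + m i • c i x := by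
      funext i
      rcases eq_or_ne (|l i| + |m i|) 0 with h | h
      · have hl : l i = 0 := abs_eq_zero.1 (by linarith [abs_nonneg (l i), abs_nonneg (m i)])
        have hm : m i = 0 := abs_eq_zero.1 (by linarith [abs_nonneg (l i), abs_nonneg (m i)])
        simp [hl, hm]
      · exact smul_inv_smul₀ h _
    exact key ▸ hx.add hy

lemma blockNormSet_bddBelow (q s u : ℝ) (f : EuclideanSpace ℝ (Fin n) → Y) :
    BddBelow (blockNormSet q s u f) := by
  refine ⟨0, ?_⟩
  rintro N ⟨l, b, -, rfl⟩
  positivity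

variable (n Y) in
/-- The block space `H_q^{s,u}(Y)` on `ℝⁿ`: classes of strongly measurable functions that have a
block decomposition. -/
def BlockSpace (q s u : ℝ) [hq : Fact (1 < q)] [hu : Fact (1 < u)] :
    Submodule ℝ (EuclideanSpace ℝ (Fin n) →ₘ[volume] Y) where
  carrier := {f | ∃ l b, IsDecomposition q s u f l b}
  add_mem' := by
    rintro f g ⟨l, b, hf⟩ ⟨m, c, hg⟩
    exact ⟨_, _, (hf.add hq.out hu.out hg).congr (AEEqFun.coeFn_add f g).symm⟩
  zero_mem' := ⟨_, _, (isDecomposition_zero hu.out).congr AEEqFun.coeFn_zero.symm⟩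
  smul_mem' := by
    rintro a f ⟨l, b, hf⟩
    exact ⟨_, _, (hf.smul a).congr (AEEqFun.coeFn_smul a f).symm⟩

/-- `‖f‖_{H_q^{s,u}(Y)}` is the infimum of `‖λ‖_{ℓ^u}` over all block decompositions of `f`. -/
noncomputable instance (q s u : ℝ) [Fact (1 < q)] [Fact (1 < u)] :
    Norm (BlockSpace n Y q s u) where
  norm f := sInf (blockNormSet q s u (f : EuclideanSpace ℝ (Fin n) →ₘ[volume] Y))

lemma BlockSpace.norm_le {q s u : ℝ} [Fact (1 < q)] [Fact (1 < u)] (f : BlockSpace n Y q s u)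
    {l : CubeIndex n → ℝ} {b : CubeIndex n → EuclideanSpace ℝ (Fin n) → Y}
    (h : IsDecomposition q s u (f : EuclideanSpace ℝ (Fin n) →ₘ[volume] Y) l b) :
    ‖f‖ ≤ (∑' i, |l i| ^ u) ^ (1 / u) :=
  csInf_le (blockNormSet_bddBelow _ _ _ _) ⟨l, b, h, rfl⟩

lemma BlockSpace.exists_lt {q s u : ℝ} [Fact (1 < q)] [Fact (1 < u)] (f : BlockSpace n Y q s u)
    {ε : ℝ} (hε : 0 < ε) :
    ∃ l b, IsDecomposition q s u (f : EuclideanSpace ℝ (Fin n) →ₘ[volume] Y) l b ∧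
      (∑' i, |l i| ^ u) ^ (1 / u) < ‖f‖ + ε := by
  obtain ⟨l, b, h⟩ := f.2
  obtain ⟨N, ⟨l', b', h', rfl⟩, hN⟩ := exists_lt_of_csInf_lt
    (s := blockNormSet q s u (f : EuclideanSpace ℝ (Fin n) →ₘ[volume] Y)) ⟨_, l, b, h, rfl⟩
    (lt_add_of_pos_right ‖f‖ hε)
  exact ⟨l', b', h', hN⟩

lemma BlockSpace.norm_smul_le' {q s u : ℝ} [Fact (1 < q)] [hu : Fact (1 < u)] (c : ℝ)
    (f : BlockSpace n Y q s u) : ‖c • f‖ ≤ ‖c‖ * ‖f‖ := by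
  have hu0 : 0 < u := by linarith [hu.out]
  refine le_of_forall_pos_le_add fun δ hδ => ?_
  obtain ⟨l, b, h, hlt⟩ := BlockSpace.exists_lt f (ε := δ / (‖c‖ + 1)) (by positivity)
  have h1 := BlockSpace.norm_le (c • f) ((h.smul c).congr (AEEqFun.coeFn_smul c _).symm)
  have h2 : (∑' i, |c * l i| ^ u) ^ (1 / u) = ‖c‖ * (∑' i, |l i| ^ u) ^ (1 / u) := by
    simp_rw [abs_mul, Real.mul_rpow (abs_nonneg c) (abs_nonneg _)]
    rw [tsum_mul_left, Real.mul_rpow (by positivity) (by positivity), ← Real.rpow_mul (abs_nonneg c),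
      mul_one_div_cancel hu0.ne', Real.rpow_one, Real.norm_eq_abs]
  rw [h2] at h1
  refine h1.trans ((mul_le_mul_of_nonneg_left hlt.le (norm_nonneg c)).trans ?_)
  rw [mul_add]
  gcongr
  rw [mul_div_assoc', div_le_iff₀ (by positivity)]
  nlinarith [norm_nonneg c]

lemma BlockSpace.norm_add_le' {q s u : ℝ} [hq : Fact (1 < q)] [hu : Fact (1 < u)]
    (f g : BlockSpace n Y q s u) : ‖f + g‖ ≤ ‖f‖ + ‖g‖ := by
  refine le_of_forall_pos_le_add fun δ hδ => ?_
  obtain ⟨l, b, hf, hlf⟩ := BlockSpace.exists_lt f (half_pos hδ)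
  obtain ⟨m, c, hg, hlg⟩ := BlockSpace.exists_lt g (half_pos hδ)
  have h1 := BlockSpace.norm_le (f + g) ((hf.add hq.out hu.out hg).congr (AEEqFun.coeFn_add _ _).symm)
  have h2 := (Real.Lp_add_le_tsum_of_nonneg hu.out.le (fun i => abs_nonneg (l i))
    (fun i => abs_nonneg (m i)) hf.summable hg.summable).2
  simp_rw [fun i => abs_of_nonneg (add_nonneg (abs_nonneg (l i)) (abs_nonneg (m i)))] at h1
  linarith

lemma BlockSpace.core (q s u : ℝ) [Fact (1 < q)] [Fact (1 < u)] :
    SeminormedSpace.Core ℝ (BlockSpace n Y q s u) where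
  norm_nonneg f := by
    refine Real.sInf_nonneg ?_
    rintro N ⟨l, b, -, rfl⟩
    positivity
  norm_smul c f := by
    refine le_antisymm (BlockSpace.norm_smul_le' c f) ?_
    rcases eq_or_ne c 0 with rfl | hc
    · rw [norm_zero, zero_mul]
      refine Real.sInf_nonneg ?_
      rintro N ⟨l, b, -, rfl⟩
      positivity
    · have h := BlockSpace.norm_smul_le' c⁻¹ (c • f)
      rw [inv_smul_smul₀ hc, norm_inv] at h
      rwa [← le_inv_mul_iff₀ (norm_pos_iff.2 hc)]
  norm_triangle f g := BlockSpace.norm_add_le' f g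

noncomputable instance (q s u : ℝ) [Fact (1 < q)] [Fact (1 < u)] :
    SeminormedAddCommGroup (BlockSpace n Y q s u) :=
  SeminormedAddCommGroup.ofCore (BlockSpace.core q s u)

noncomputable instance (q s u : ℝ) [Fact (1 < q)] [Fact (1 < u)] :
    NormedSpace ℝ (BlockSpace n Y q s u) where
  norm_smul_le := BlockSpace.norm_smul_le'

end Block

/-- The conjugate exponent `p' = p / (p - 1)` of `p > 1` satisfies `p' > 1`. -/
instance (p : ℝ) [hp : Fact (1 < p)] : Fact (1 < p.conjExponent) :=
  ⟨(Real.HolderConjugate.conjExponent hp.out).symm.lt⟩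

end BourgainMorrey

/-! Sending `f` to its weighted restrictions `|Q|^(1/t - 1/p) f|_Q` embeds the Morrey space
isometrically into `ℓ^r(L^p(Q; X))`. By Hahn-Banach a functional `L` extends to that sum without
increase of norm. The coordinates `M_Q` of the extension have `ℓ^{r'}` norm at most `‖L‖`
(`sum_norm_comp_rpow_le`), and each is integration against some `h_Q` in `L^{p'}(Q; X*)`
(`exists_representation`). Since `1/p' - 1/t' = 1/t - 1/p`, normalizing `|Q|^(1/t - 1/p) h_Q` by
`‖M_Q‖` gives a block, and `g = ∑ ‖M_Q‖ b_Q` represents `L` with `‖g‖ ≤ ‖L‖`. The opposite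
inequality is Hölder on each cube and then in `ℓ^{r'}`-`ℓ^r` (`lintegral_tsum_block_le`). The same
estimate against the indicator of a unit cube makes every block series converge absolutely almost
everywhere. That indicator has finite Morrey norm because `p < t` controls the large cubes and `t <
r` the small ones. Indicators also give uniqueness of `g`, and uniqueness together with `‖g‖ ≤ ‖L‖`
gives the isometry. Reflexivity enters the representation through the Radon-Nikodym property of
`X*`. For fixed `x`, the averages of `s ↦ l(1_s x)` over refining finite partitions are a martingale
converging to a scalar density. Fatou bounds the lower limit of the norms of the vector averages in
`L^q`, so weak-* cluster points exist almost everywhere. By reflexivity they stay in the norm-closed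
separable span of the averages, which makes the density strongly measurable. -/

namespace BourgainMorrey

open Filter Topology MeasurableSpace ProbabilityTheory

/-! ### Duality for finite `ℓ^p` sums -/

section FiniteDuality

/-- If `x ↦ ∑ i ∈ s, J i (x i)` is contractive from `ℓ^p` to `E`, then the restrictions `Λ ∘ J i` of
a functional `Λ` on `E` have `ℓ^q` norm at most `‖Λ‖`. -/
theorem sum_norm_comp_rpow_le {ι E : Type*} {F : ι → Type*} [NormedAddCommGroup E]
    [NormedSpace ℝ E] [∀ i, NormedAddCommGroup (F i)] [∀ i, NormedSpace ℝ (F i)] {p q : ℝ}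
    (hpq : p.HolderConjugate q) (s : Finset ι) (Λ : StrongDual ℝ E) (J : ∀ i, F i →L[ℝ] E)
    (hJ : ∀ x : ∀ i, F i, ‖∑ i ∈ s, J i (x i)‖ ≤ (∑ i ∈ s, ‖x i‖ ^ p) ^ (1 / p)) :
    ∑ i ∈ s, ‖Λ ∘L J i‖ ^ q ≤ ‖Λ‖ ^ q := by
  have hp := hpq.pos
  have hq := hpq.symm.pos
  -- Apply `Λ` to `∑ J i (a i • x i)` with `x i` almost norming `Λ ∘L J i`; `ε` is chosen so that
  -- the total error `ε * ∑ a i` stays below `δ`.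
  have key : ∀ a : ι → ℝ, (∀ i, 0 ≤ a i) →
      ∑ i ∈ s, a i * ‖Λ ∘L J i‖ ≤ ‖Λ‖ * (∑ i ∈ s, a i ^ p) ^ (1 / p) := by
    intro a ha
    refine le_of_forall_pos_le_add fun δ hδ => ?_
    have hA : 0 ≤ ∑ i ∈ s, a i := Finset.sum_nonneg fun i _ => ha i
    set ε := δ / (∑ i ∈ s, a i + 1) with hε
    have hε0 : 0 < ε := by positivity
    have hx : ∀ i, ∃ x : F i, ‖x‖ ≤ 1 ∧ ‖Λ ∘L J i‖ - ε ≤ Λ (J i x) := by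
      intro i
      obtain ⟨x, hx1, hx2⟩ := (Λ ∘L J i).exists_lt_apply_of_lt_opNorm
        (sub_lt_self ‖Λ ∘L J i‖ hε0)
      rcases le_or_gt 0 (Λ (J i x)) with h | h
      · exact ⟨x, hx1.le, by simpa [abs_of_nonneg h] using hx2.le⟩
      · exact ⟨-x, by simpa using hx1.le, by simpa [abs_of_neg h] using hx2.le⟩
    choose x hx1 hx2 using hx
    calc ∑ i ∈ s, a i * ‖Λ ∘L J i‖
        ≤ ∑ i ∈ s, (Λ (J i (a i • x i)) + ε * a i) := by
          refine Finset.sum_le_sum fun i _ => ?_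
          rw [map_smul, map_smul, smul_eq_mul]
          nlinarith [mul_le_mul_of_nonneg_left (hx2 i) (ha i)]
      _ = Λ (∑ i ∈ s, J i (a i • x i)) + ε * ∑ i ∈ s, a i := by
          rw [Finset.sum_add_distrib, map_sum, Finset.mul_sum]
      _ ≤ ‖Λ‖ * (∑ i ∈ s, a i ^ p) ^ (1 / p) + δ := by
          refine add_le_add ?_ ?_
          · refine (le_abs_self _).trans ((Λ.le_opNorm _).trans ?_)
            refine mul_le_mul_of_nonneg_left ((hJ _).trans ?_) (norm_nonneg _)
            refine Real.rpow_le_rpow (Finset.sum_nonneg fun i _ => by positivity) ?_ (by positivity)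
            refine Finset.sum_le_sum fun i _ => Real.rpow_le_rpow (norm_nonneg _) ?_ hp.le
            rw [norm_smul, Real.norm_of_nonneg (ha i)]
            exact mul_le_of_le_one_right (ha i) (hx1 i)
          · rw [hε, div_mul_eq_mul_div, div_le_iff₀ (by positivity)]
            nlinarith
  set S := ∑ i ∈ s, ‖Λ ∘L J i‖ ^ q with hS
  have hS0 : 0 ≤ S := Finset.sum_nonneg fun i _ => by positivity
  -- Equality case of Hölder: the exponent `q - 1` turns both `a i * ‖Λ ∘L J i‖` and `a i ^ p` into
  -- `‖Λ ∘L J i‖ ^ q`, so that `S ≤ ‖Λ‖ * S ^ (1 / p)`.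
  have h := key (fun i => ‖Λ ∘L J i‖ ^ (q - 1)) fun i => by positivity
  have e1 : ∀ i, ‖Λ ∘L J i‖ ^ (q - 1) * ‖Λ ∘L J i‖ = ‖Λ ∘L J i‖ ^ q := fun i => by
    conv_rhs => rw [← sub_add_cancel q 1]
    rw [Real.rpow_add_one' (norm_nonneg _) (by simpa using hq.ne')]
  have e2 : ∀ i, (‖Λ ∘L J i‖ ^ (q - 1)) ^ p = ‖Λ ∘L J i‖ ^ q := fun i => by
    rw [← Real.rpow_mul (norm_nonneg _), hpq.symm.sub_one_mul_conj]
  simp only [e1, e2] at h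
  rcases hS0.eq_or_lt with h0 | h0
  · rw [← h0]; positivity
  · have h2 : S ^ (1 / q) ≤ ‖Λ‖ := by
      have : S = S ^ (1 / q) * S ^ (1 / p) := by
        rw [← Real.rpow_add h0, one_div, one_div, hpq.symm.inv_add_inv_eq_one, Real.rpow_one]
      have h3 : S ^ (1 / q) * S ^ (1 / p) ≤ ‖Λ‖ * S ^ (1 / p) := by rw [← this]; exact h
      exact le_of_mul_le_mul_right h3 (by positivity)
    calc S = (S ^ (1 / q)) ^ q := by
          rw [← Real.rpow_mul hS0, one_div_mul_cancel hq.ne', Real.rpow_one]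
      _ ≤ ‖Λ‖ ^ q := Real.rpow_le_rpow (by positivity) h2 hq.le

end FiniteDuality

/-! ### Weak-* cluster points and separability in a dual space -/

section WeakLimit

variable {X : Type*} [NormedAddCommGroup X] [NormedSpace ℝ X]

/-- A sequence of functionals whose norms have finite lower limit has a weak-* cluster point. -/
theorem exists_weakStar_cluster (y : ℕ → StrongDual ℝ X)
    (h : liminf (fun k => ‖y k‖ₑ) atTop ≠ ∞) :
    ∃ z : StrongDual ℝ X, ‖z‖ₑ ≤ liminf (fun k => ‖y k‖ₑ) atTop ∧
      ∀ x c, Tendsto (fun k => y k x) atTop (𝓝 c) → z x = c := by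
  set C := liminf (fun k => ‖y k‖ₑ) atTop with hC
  have hfreq : ∀ m : ℕ, ∃ᶠ k in atTop, ‖y k‖ ≤ C.toReal + 1 / ((m : ℝ) + 1) := by
    intro m
    have hpos : (0 : ℝ) < 1 / ((m : ℝ) + 1) := by positivity
    have hlt : C < C + ENNReal.ofReal (1 / ((m : ℝ) + 1)) :=
      ENNReal.lt_add_right h (by simpa using hpos)
    refine (frequently_lt_of_liminf_lt (by isBoundedDefault) hlt).mono fun k hk => ?_
    have := ENNReal.toReal_mono (by simp [h]) hk.le
    rwa [toReal_enorm, ENNReal.toReal_add h (by simp), ENNReal.toReal_ofReal hpos.le] at this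
  obtain ⟨φ, hφ, hφb⟩ := extraction_forall_of_frequently hfreq
  let u : ℕ → WeakDual ℝ X := fun m => StrongDual.toWeakDual (y (φ m))
  have hmem : ∀ m, u m ∈ WeakDual.toStrongDual ⁻¹' Metric.closedBall (0 : StrongDual ℝ X)
      (C.toReal + 1) := by
    intro m
    refine mem_closedBall_zero_iff.2 ((hφb m).trans ?_)
    gcongr
    rw [div_le_one (by positivity)]
    linarith [(Nat.cast_nonneg m : (0 : ℝ) ≤ m)]
  -- Balls of a dual are weak-* compact but need not be sequentially compact, so the limit is taken
  -- along a free ultrafilter; it refines `atTop`, hence ordinary limits persist along it.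
  obtain ⟨z, -, hz⟩ := (WeakDual.isCompact_closedBall (0 : StrongDual ℝ X) (C.toReal + 1)).ultrafilter_le_nhds
    ((hyperfilter ℕ : Ultrafilter ℕ).map u)
    (by
      rw [le_principal_iff]
      exact Filter.Eventually.of_forall (f := (hyperfilter ℕ : Filter ℕ)) hmem)
  have hlim : ∀ x, Tendsto (fun m => y (φ m) x) (hyperfilter ℕ : Filter ℕ) (𝓝 (z x)) := by
    intro x
    exact ((WeakDual.eval_continuous x).tendsto z).comp hz
  refine ⟨WeakDual.toStrongDual z, ?_, fun x c hc => ?_⟩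
  · rw [← ENNReal.ofReal_toReal h, ← ofReal_norm]
    refine ENNReal.ofReal_le_ofReal (ContinuousLinearMap.opNorm_le_bound _ ENNReal.toReal_nonneg
      fun x => ?_)
    have h1 := (hlim x).norm
    have h2 : Tendsto (fun m : ℕ => (C.toReal + 1 / ((m : ℝ) + 1)) * ‖x‖) (hyperfilter ℕ : Filter ℕ)
        (𝓝 ((C.toReal + 0) * ‖x‖)) :=
      ((tendsto_one_div_add_atTop_nhds_zero_nat.const_add _).mul_const _).mono_left
        Nat.hyperfilter_le_atTop
    rw [add_zero] at h2
    exact le_of_tendsto_of_tendsto' h1 h2 fun m =>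
      (ContinuousLinearMap.le_opNorm _ _).trans (by gcongr; exact hφb m)
  · exact tendsto_nhds_unique (hlim x)
      ((hc.comp hφ.tendsto_atTop).mono_left Nat.hyperfilter_le_atTop)

/-- In the dual of a reflexive space, a closed subspace is the annihilator of its preannihilator. -/
theorem mem_of_forall_apply_eq_zero
    (hX : Function.Surjective (NormedSpace.inclusionInDoubleDual ℝ X))
    (Y : Submodule ℝ (StrongDual ℝ X)) (hY : IsClosed (Y : Set (StrongDual ℝ X)))
    {z : StrongDual ℝ X} (h : ∀ x, (∀ y ∈ Y, y x = 0) → z x = 0) : z ∈ Y := by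
  by_contra hz
  obtain ⟨f, u, hf1, hf2⟩ := geometric_hahn_banach_closed_point Y.convex hY hz
  have h0 : ∀ y ∈ Y, f y = 0 := by
    intro y hy
    by_contra hne
    have := hf1 ((u / f y) • y) (Y.smul_mem _ hy)
    rw [map_smul, smul_eq_mul, div_mul_cancel₀ _ hne] at this
    exact lt_irrefl _ this
  -- Reflexivity makes the separating functional an evaluation at some `x`, which is annihilated by
  -- `Y`.
  obtain ⟨x, rfl⟩ := hX f
  have hu : 0 < u := by simpa using hf1 0 Y.zero_mem
  have : z x = 0 := h x fun y hy => by simpa using h0 y hy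
  rw [NormedSpace.dual_def, this] at hf2
  exact lt_asymm hu hf2

/-- A separable set of functionals is normed by countably many vectors. -/
theorem exists_norming_seq {Y : Set (StrongDual ℝ X)} (hY : TopologicalSpace.IsSeparable Y) :
    ∃ D : Set X, D.Countable ∧ ∀ y ∈ Y, ∀ r : ℝ, 0 ≤ r → (‖y‖ ≤ r ↔ ∀ x ∈ D, |y x| ≤ r) := by
  obtain ⟨c, hc, hYc⟩ := hY
  have hx : ∀ (y : StrongDual ℝ X) (m : ℕ), ∃ x : X, ‖x‖ ≤ 1 ∧ ‖y‖ - 1 / ((m : ℝ) + 1) ≤ |y x| := by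
    intro y m
    obtain ⟨x, hx1, hx2⟩ := y.exists_lt_apply_of_lt_opNorm
      (sub_lt_self ‖y‖ (by positivity : (0 : ℝ) < 1 / ((m : ℝ) + 1)))
    exact ⟨x, hx1.le, hx2.le⟩
  choose x hx1 hx2 using hx
  refine ⟨⋃ y ∈ c, Set.range (x y), hc.biUnion fun y _ => Set.countable_range _,
    fun y hy r hr => ⟨fun h z hz => ?_, fun h => ?_⟩⟩
  · simp only [Set.mem_iUnion, Set.mem_range] at hz
    obtain ⟨y', -, m, rfl⟩ := hz
    exact (y.le_opNorm _).trans ((mul_le_of_le_one_right (norm_nonneg _) (hx1 _ _)).trans h)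
  · refine le_of_forall_pos_le_add fun ε hε => ?_
    -- Three errors of `ε / 3`: replacing `y` by `y'` in the norm, almost norming `y'`, and going
    -- back from `y'` to `y` at the chosen vector.
    obtain ⟨y', hy', hd⟩ := Metric.mem_closure_iff.1 (hYc hy) (ε / 3) (by positivity)
    obtain ⟨m, hm⟩ := exists_nat_one_div_lt (by positivity : 0 < ε / 3)
    have h1 := h (x y' m) (Set.mem_biUnion hy' ⟨m, rfl⟩)
    have h2 : ‖y‖ ≤ ‖y'‖ + ‖y - y'‖ := norm_le_insert' _ _
    have h3 : |y' (x y' m)| ≤ |y (x y' m)| + |(y' - y) (x y' m)| := by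
      simpa using abs_add_le (y (x y' m)) ((y' - y) (x y' m))
    have h4 : |(y' - y) (x y' m)| ≤ ‖y - y'‖ := by
      rw [norm_sub_rev]
      exact ((y' - y).le_opNorm _).trans (mul_le_of_le_one_right (norm_nonneg _) (hx1 _ _))
    rw [dist_eq_norm] at hd
    linarith [hx2 y' m]

/-- A function with values in a separable set is strongly measurable as soon as its distances to
the points of that set are measurable. -/
theorem stronglyMeasurable_of_measurable_dist {Ω E : Type*} [MeasurableSpace Ω]
    [PseudoMetricSpace E] {Y : Set E} (hY : TopologicalSpace.IsSeparable Y) {f : Ω → E}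
    (hfY : ∀ w, f w ∈ Y) (hf : ∀ y ∈ Y, Measurable fun w => dist (f w) y) :
    StronglyMeasurable f := by
  borelize E
  rw [stronglyMeasurable_iff_measurable_separable]
  refine ⟨?_, hY.mono (Set.range_subset_iff.2 hfY)⟩
  obtain ⟨c, hcY, hc, hYc⟩ := hY.exists_countable_dense_subset
  refine measurable_of_isOpen fun U hU => ?_
  -- As `f` takes values in `Y`, countably many balls inside `U`, centred in a dense subset of `Y`,
  -- already capture the preimage.
  have : f ⁻¹' U = ⋃ y ∈ c, ⋃ m ∈ {m : ℕ | Metric.ball y (1 / ((m : ℝ) + 1)) ⊆ U},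
      {w | dist (f w) y < 1 / ((m : ℝ) + 1)} := by
    ext w
    simp only [Set.mem_preimage, Set.mem_iUnion, exists_prop, Set.mem_ofPred_eq]
    constructor
    · intro hw
      obtain ⟨ε, hε, hball⟩ := Metric.isOpen_iff.1 hU _ hw
      obtain ⟨m, hm⟩ := exists_nat_one_div_lt (half_pos hε)
      obtain ⟨y, hy, hd⟩ := Metric.mem_closure_iff.1 (hYc (hfY w)) (1 / ((m : ℝ) + 1)) (by positivity)
      refine ⟨y, hy, m, fun z hz => hball ?_, hd⟩
      rw [Metric.mem_ball] at hz ⊢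
      calc dist z (f w) ≤ dist z y + dist (f w) y := dist_triangle_right _ _ _
        _ < ε := by linarith
    · rintro ⟨y, -, m, hm, hd⟩
      exact hm hd
  rw [this]
  refine MeasurableSet.biUnion hc fun y hy => MeasurableSet.biUnion (Set.to_countable _) fun m _ => ?_
  exact measurableSet_lt (hf y (hcY hy)) measurable_const

end WeakLimit

/-! ### Atoms of refining finite partitions of a countably generated space -/

section Partition

variable {Ω : Type*} [MeasurableSpace Ω] [CountablyGenerated Ω]

/-- The atom of the `k`-th countable partition that contains `w`. -/
noncomputable def atomOf (k : ℕ) (w : Ω) : countablePartition Ω k :=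
  ⟨countablePartitionSet k w, countablePartitionSet_mem k w⟩

noncomputable instance (k : ℕ) : Fintype (countablePartition Ω k) := Fintype.ofFinite _

lemma atomOf_eq_iff {k : ℕ} {w : Ω} {s : countablePartition Ω k} : atomOf k w = s ↔ w ∈ s.1 := by
  rw [atomOf, Subtype.ext_iff]
  exact countablePartitionSet_eq_iff w s.2

lemma stronglyMeasurable_comp_atomOf {E : Type*} [TopologicalSpace E] (k : ℕ)
    (F : countablePartition Ω k → E) :
    StronglyMeasurable[countableFiltration Ω k] fun w => F (atomOf k w) := by
  let _ : MeasurableSpace (countablePartition Ω k) := ⊤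
  exact (StronglyMeasurable.of_discrete (f := F)).comp_measurable
    (measurable_countablePartitionSet_subtype k ⊤)

lemma lintegral_comp_atomOf (μ : Measure Ω) (k : ℕ) (F : countablePartition Ω k → ℝ≥0∞) :
    ∫⁻ w, F (atomOf k w) ∂μ = ∑ s, F s * μ s.1 := by
  let _ : MeasurableSpace (countablePartition Ω k) := ⊤
  have hm : Measurable (atomOf k : Ω → _) :=
    (measurable_countablePartitionSet_subtype k ⊤).mono ((countableFiltration Ω).le k) le_rfl
  rw [← lintegral_map (f := F) .of_discrete hm, lintegral_fintype]
  refine Finset.sum_congr rfl fun s _ => ?_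
  rw [Measure.map_apply hm (MeasurableSet.singleton s)]
  congr 2
  ext w
  simp [atomOf_eq_iff]

end Partition

/-! ### Scalar densities and averages of a functional on `L^p` -/

section Representation

variable {Ω : Type*} [MeasurableSpace Ω] {μ : Measure Ω} [IsFiniteMeasure μ]
  {X : Type*} [NormedAddCommGroup X] [NormedSpace ℝ X] {p q : ℝ}

/-- `x ↦ 1_s x` as a continuous linear map into `L^p`. -/
noncomputable def indicatorCLM (μ : Measure Ω) [IsFiniteMeasure μ] (X : Type*)
    [NormedAddCommGroup X] [NormedSpace ℝ X] (p : ℝ≥0∞) [Fact (1 ≤ p)] {s : Set Ω}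
    (hs : MeasurableSet s) : X →L[ℝ] Lp X p μ :=
  LinearMap.mkContinuous
    { toFun := fun x => indicatorConstLp p hs (measure_ne_top μ s) x
      map_add' := fun _ _ => (indicatorConstLp_add ..).symm
      map_smul' := fun c x => by
        refine Lp.ext ?_
        filter_upwards [indicatorConstLp_coeFn (p := p) (hs := hs) (hμs := measure_ne_top μ s)
          (c := c • x), Lp.coeFn_smul c (indicatorConstLp p hs (measure_ne_top μ s) x),
          indicatorConstLp_coeFn (p := p) (hs := hs) (hμs := measure_ne_top μ s) (c := x)]
          with w h1 h2 h3
        rw [h1, RingHom.id_apply, h2, Pi.smul_apply, h3]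
        by_cases hw : w ∈ s <;> simp [hw] }
    (μ.real s ^ (1 / p.toReal)) fun x => by
      rw [mul_comm]
      exact norm_indicatorConstLp_le (hs := hs) (hμs := measure_ne_top μ s)

lemma indicatorCLM_apply (p : ℝ≥0∞) [Fact (1 ≤ p)] {s : Set Ω} (hs : MeasurableSet s) (x : X) :
    indicatorCLM μ X p hs x = indicatorConstLp p hs (measure_ne_top μ s) x := rfl

lemma coeFn_indicatorCLM (p : ℝ≥0∞) [Fact (1 ≤ p)] {s : Set Ω} (hs : MeasurableSet s) (x : X) :
    indicatorCLM μ X p hs x =ᵐ[μ] s.indicator fun _ => x :=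
  indicatorConstLp_coeFn (hs := hs) (hμs := measure_ne_top μ s)

/-- A functional on `L^p(μ; X)` with `μ` finite has scalar densities. -/
theorem exists_scalar_density [Fact (1 ≤ ENNReal.ofReal p)]
    (l : StrongDual ℝ (Lp X (ENNReal.ofReal p) μ)) (x : X) :
    ∃ f : Ω → ℝ, Measurable f ∧ Integrable f μ ∧
      ∀ s (hs : MeasurableSet s), ∫ w in s, f w ∂μ = l (indicatorCLM μ X _ hs x) := by
  classical
  let ν : SignedMeasure Ω :=
    { measureOf' := fun s => if hs : MeasurableSet s then l (indicatorCLM μ X _ hs x) else 0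
      empty' := by
        rw [dif_pos MeasurableSet.empty, indicatorCLM_apply, indicatorConstLp_empty, map_zero]
      not_measurable' := fun s hs => dif_neg hs
      m_iUnion' := fun f hf hd => by
        rw [dif_pos (MeasurableSet.iUnion hf)]
        simp only [hf, dite_true]
        have hmf : ∀ F : Finset ℕ, MeasurableSet (⋃ i ∈ F, f i) := fun F =>
          F.measurableSet_biUnion fun i _ => hf i
        have hsum : ∀ F : Finset ℕ, ∑ i ∈ F, l (indicatorCLM μ X (ENNReal.ofReal p) (hf i) x) =
            l (indicatorCLM μ X _ (hmf F) x) := by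
          intro F
          rw [← map_sum]
          congr 1
          refine Lp.ext ?_
          have h1 : ∀ᵐ w ∂μ, ∀ i, indicatorCLM μ X (ENNReal.ofReal p) (hf i) x w =
              (f i).indicator (fun _ => x) w :=
            ae_all_iff.2 fun i => coeFn_indicatorCLM _ (hf i) x
          filter_upwards [Lp.coeFn_fun_finsetSum F
            (fun i => indicatorCLM μ X (ENNReal.ofReal p) (hf i) x), h1,
            coeFn_indicatorCLM (μ := μ) (ENNReal.ofReal p) (hmf F) x] with w h2 h1 h3
          rw [h2, h3,
            Finset.indicator_biUnion_apply F f (fun i _ j _ hij => hd hij)]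
          exact Finset.sum_congr rfl fun i _ => h1 i
        rw [HasSum]
        simp only [SummationFilter.unconditional_filter, hsum]
        refine (l.continuous.tendsto _).comp ?_
        simp only [indicatorCLM_apply]
        -- Countable additivity of `ν`: finite partial unions tend to the whole union in measure,
        -- hence their indicators converge in `L^p` because the exponent is finite.
        refine tendsto_indicatorConstLp_set ENNReal.ofReal_ne_top ?_
        have h4 : ∀ F : Finset ℕ, μ (symmDiff (⋃ i ∈ F, f i) (⋃ i, f i)) =
            μ (⋃ i, f i) - ∑ i ∈ F, μ (f i) := by
          intro F
          have hsub : (⋃ i ∈ F, f i) ⊆ ⋃ i, f i := Set.iUnion₂_subset_iUnion _ _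
          rw [symmDiff_of_le hsub, measure_sdiff hsub (hmf F).nullMeasurableSet
            (measure_ne_top μ _), measure_biUnion_finset (fun i _ j _ hij => hd hij)
            fun i _ => hf i]
        simp only [h4]
        rw [measure_iUnion hd hf]
        have h5 := ENNReal.Tendsto.sub (tendsto_const_nhds (x := ∑' i, μ (f i)))
          (ENNReal.summable (f := fun i => μ (f i))).hasSum
          (Or.inl (by rw [← measure_iUnion hd hf]; exact measure_ne_top μ _))
        simpa using h5 }
  have hν : ∀ s (hs : MeasurableSet s), ν s = l (indicatorCLM μ X _ hs x) := fun s hs => dif_pos hs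
  -- A null set has zero indicator in `L^p`, so Radon-Nikodym applies to `ν`.
  have hac : ν ≪ᵥ μ.toENNRealVectorMeasure := by
    refine VectorMeasure.AbsolutelyContinuous.mk fun s hs h0 => ?_
    rw [Measure.toENNRealVectorMeasure_apply_measurable hs] at h0
    rw [hν s hs]
    have : indicatorCLM μ X (ENNReal.ofReal p) hs x = 0 := by
      rw [← norm_le_zero_iff, indicatorCLM_apply]
      refine norm_indicatorConstLp_le.trans ?_
      have hp1 : (1 : ℝ≥0∞) ≤ ENNReal.ofReal p := Fact.out
      have : (ENNReal.ofReal p).toReal ≠ 0 := by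
        rw [ENNReal.toReal_ne_zero]
        exact ⟨(one_pos.trans_le hp1).ne', ENNReal.ofReal_ne_top⟩
      simp [Measure.real, h0, this]
    rw [this, map_zero]
  have hd := (SignedMeasure.absolutelyContinuous_iff_withDensityᵥ_rnDeriv_eq ν μ).1 hac
  refine ⟨ν.rnDeriv μ, SignedMeasure.measurable_rnDeriv _ _, SignedMeasure.integrable_rnDeriv _ _,
    fun s hs => ?_⟩
  rw [← withDensityᵥ_apply (SignedMeasure.integrable_rnDeriv _ _) hs, hd, hν s hs]

variable [CountablyGenerated Ω]

/-- The average of the set function `s ↦ (x ↦ l (1_s x))` over an atom of a partition. -/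
noncomputable def atomAverage [Fact (1 ≤ ENNReal.ofReal p)]
    (l : StrongDual ℝ (Lp X (ENNReal.ofReal p) μ)) (k : ℕ) (s : countablePartition Ω k) :
    StrongDual ℝ X :=
  (μ.real s.1)⁻¹ • (l ∘L indicatorCLM μ X _ (measurableSet_countablePartition k s.2))

/-- The maps `μ(s)^(-1/p) 1_s` embed `ℓ^p` over the atoms contractively into `L^p`, so finite
duality bounds the `ℓ^q` norm of the restrictions of `l`. As `1 - q = -q / p`, the `q`-th power of
such a restriction norm is the contribution of its atom to the integral. The bound does not depend
on `k`, as Fatou's lemma will require. -/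
theorem lintegral_atomAverage_le [Fact (1 ≤ ENNReal.ofReal p)] (hpq : p.HolderConjugate q)
    (l : StrongDual ℝ (Lp X (ENNReal.ofReal p) μ)) (k : ℕ) :
    ∫⁻ w, ‖atomAverage l k (atomOf k w)‖ₑ ^ q ∂μ ≤ ‖l‖ₑ ^ q := by
  have hp := hpq.pos
  have hq := hpq.symm.pos
  let J : ∀ _ : countablePartition Ω k, X →L[ℝ] Lp X (ENNReal.ofReal p) μ := fun s =>
    μ.real s.1 ^ (-(1 / p)) • indicatorCLM μ X _ (measurableSet_countablePartition k s.2)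
  have hJ : ∀ x : countablePartition Ω k → X,
      ‖∑ s, J s (x s)‖ ≤ (∑ s, ‖x s‖ ^ p) ^ (1 / p) := by
    intro x
    have hae : ⇑(∑ s, J s (x s)) =ᵐ[μ]
        fun w => (fun s => μ.real s.1 ^ (-(1 / p)) • x s) (atomOf k w) := by
      have h1 : ∀ᵐ w ∂μ, ∀ s, J s (x s) w =
          s.1.indicator (fun _ => μ.real s.1 ^ (-(1 / p)) • x s) w := by
        refine ae_all_iff.2 fun s => ?_
        have : J s (x s) = indicatorCLM μ X _ (measurableSet_countablePartition k s.2)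
          (μ.real s.1 ^ (-(1 / p)) • x s) := by rw [map_smul]; rfl
        rw [this]
        exact coeFn_indicatorCLM _ _ _
      filter_upwards [Lp.coeFn_fun_finsetSum Finset.univ fun s => J s (x s), h1] with w h2 h1
      rw [h2, Finset.sum_eq_single (atomOf k w)]
      · rw [h1, Set.indicator_of_mem (atomOf_eq_iff.1 rfl)]
      · intro s _ hs
        rw [h1, Set.indicator_of_notMem]
        exact fun hw => hs (atomOf_eq_iff.2 hw).symm
      · simp
    rw [Lp.norm_def, eLpNorm_congr_ae hae, eLpNorm_eq_lintegral_rpow_enorm_toReal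
      (by simpa using hp) ENNReal.ofReal_ne_top, ENNReal.toReal_ofReal hp.le,
      lintegral_comp_atomOf μ k fun s => ‖μ.real s.1 ^ (-(1 / p)) • x s‖ₑ ^ p,
      ← ENNReal.toReal_rpow]
    refine Real.rpow_le_rpow ENNReal.toReal_nonneg ?_ (by positivity)
    refine ENNReal.toReal_le_of_le_ofReal (Finset.sum_nonneg fun _ _ => by positivity) ?_
    rw [ENNReal.ofReal_sum_of_nonneg fun _ _ => by positivity]
    refine Finset.sum_le_sum fun s _ => ?_
    rw [← ENNReal.ofReal_toReal (measure_ne_top μ s.1), ← ofReal_norm,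
      ENNReal.ofReal_rpow_of_nonneg (norm_nonneg _) hp.le, ← ENNReal.ofReal_mul (by positivity)]
    refine ENNReal.ofReal_le_ofReal ?_
    change ‖μ.real s.1 ^ (-(1 / p)) • x s‖ ^ p * μ.real s.1 ≤ _
    rcases (measureReal_nonneg (μ := μ) (s := s.1)).eq_or_lt with h0 | h0
    · rw [← h0, mul_zero]; positivity
    · rw [norm_smul, Real.norm_of_nonneg (by positivity), Real.mul_rpow (by positivity)
        (norm_nonneg _), ← Real.rpow_mul h0.le, neg_mul, one_div_mul_cancel hp.ne',
        Real.rpow_neg_one]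
      exact le_of_eq (by field_simp)
  have h := sum_norm_comp_rpow_le hpq Finset.univ l J hJ
  rw [lintegral_comp_atomOf μ k fun s => ‖atomAverage l k s‖ₑ ^ q, ← ofReal_norm,
    ENNReal.ofReal_rpow_of_nonneg (norm_nonneg _) hq.le]
  refine le_trans ?_ (ENNReal.ofReal_le_ofReal h)
  rw [ENNReal.ofReal_sum_of_nonneg fun _ _ => by positivity]
  refine Finset.sum_le_sum fun s _ => ?_
  rw [← ENNReal.ofReal_toReal (measure_ne_top μ s.1), ← ofReal_norm,
    ENNReal.ofReal_rpow_of_nonneg (norm_nonneg _) hq.le, ← ENNReal.ofReal_mul (by positivity)]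
  refine ENNReal.ofReal_le_ofReal ?_
  change ‖atomAverage l k s‖ ^ q * μ.real s.1 ≤ _
  have e : l ∘L J s = μ.real s.1 ^ (-(1 / p)) •
      (l ∘L indicatorCLM μ X _ (measurableSet_countablePartition k s.2)) := by
    ext x; simp [J]
  rw [e, atomAverage, norm_smul, norm_smul]
  rcases (measureReal_nonneg (μ := μ) (s := s.1)).eq_or_lt with h0 | h0
  · rw [← h0, mul_zero]; positivity
  · rw [Real.norm_of_nonneg (by positivity), Real.norm_of_nonneg (by positivity),
      Real.mul_rpow (by positivity) (norm_nonneg _), Real.mul_rpow (by positivity) (norm_nonneg _),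
      mul_right_comm]
    gcongr
    refine le_of_eq ?_
    rw [← Real.rpow_neg_one, ← Real.rpow_mul h0.le, ← Real.rpow_mul h0.le,
      ← Real.rpow_add_one h0.ne']
    congr 1
    have := hpq.symm.div_conj_eq_sub_one
    have h2 : -(1 / p) * q = -(q / p) := by ring
    rw [h2, this]
    ring

/-- The averages converge to the scalar densities. -/
theorem ae_tendsto_atomAverage_apply [Fact (1 ≤ ENNReal.ofReal p)]
    (l : StrongDual ℝ (Lp X (ENNReal.ofReal p) μ)) (x : X) {f : Ω → ℝ} (hfm : Measurable f)
    (hfi : Integrable f μ)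
    (hf : ∀ s (hs : MeasurableSet s), ∫ w in s, f w ∂μ = l (indicatorCLM μ X _ hs x)) :
    ∀ᵐ w ∂μ, Tendsto (fun k => atomAverage l k (atomOf k w) x) atTop (𝓝 (f w)) := by
  -- For fixed `x` the averages are the conditional expectations of `f` on the partition σ-algebras,
  -- whose sets are finite unions of atoms; Lévy's upward theorem then gives the limit.
  have hc : ∀ k, (fun w => atomAverage l k (atomOf k w) x) =ᵐ[μ]
      μ[f | countableFiltration Ω k] := by
    intro k
    have hsm := stronglyMeasurable_comp_atomOf k fun s => atomAverage l k s x
    have hint : Integrable (fun w => atomAverage l k (atomOf k w) x) μ := by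
      refine Integrable.of_bound (hsm.mono ((countableFiltration Ω).le k)).aestronglyMeasurable
        (∑ s, ‖atomAverage l k s x‖) (Eventually.of_forall fun w => ?_)
      exact Finset.single_le_sum (f := fun s => ‖atomAverage l k s x‖)
        (fun _ _ => norm_nonneg _) (Finset.mem_univ (atomOf k w))
    refine ae_eq_condExp_of_forall_setIntegral_eq ((countableFiltration Ω).le k) hfi
      (fun _ _ _ => hint.integrableOn) ?_ hsm.aestronglyMeasurable
    intro s hs _
    obtain ⟨S, hS, rfl⟩ := (measurableSet_generateFrom_countablePartition_iff k s).1 hs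
    have hatom : ∀ t ∈ countablePartition Ω k,
        ∫ w in t, atomAverage l k (atomOf k w) x ∂μ = ∫ w in t, f w ∂μ := by
      intro t ht
      have htm := measurableSet_countablePartition k ht
      rw [setIntegral_congr_fun htm (g := fun _ => atomAverage l k ⟨t, ht⟩ x)
        (fun w hw => by rw [atomOf_eq_iff.2 (show w ∈ (⟨t, ht⟩ : countablePartition Ω k).1 from hw)]),
        setIntegral_const, hf t htm, atomAverage, smul_apply, smul_smul,
        ContinuousLinearMap.comp_apply]
      -- On a null atom the average is the default value `0`, and both integrals vanish.
      rcases eq_or_ne (μ.real t) 0 with h0 | h0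
      · have h1 : ∫ w in t, f w ∂μ = 0 := by
          refine setIntegral_measure_zero _ ?_
          simpa [Measure.real, ENNReal.toReal_eq_zero_iff] using h0
        rw [← hf t htm, h1, smul_zero]
      · rw [mul_inv_cancel₀ h0, one_smul]
    rw [Set.sUnion_eq_biUnion]
    have hd : Set.PairwiseDisjoint (S : Set (Set Ω)) id := fun a ha b hb hab =>
      disjoint_countablePartition (hS ha) (hS hb) hab
    have hm : ∀ t ∈ S, MeasurableSet (id t) := fun t ht => measurableSet_countablePartition k (hS ht)
    have e1 := integral_biUnion_finset S hm hd (fun t _ => hint.integrableOn)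
    have e2 := integral_biUnion_finset S hm hd (fun t _ => hfi.integrableOn)
    simp only [id, Finset.mem_coe] at e1 e2 ⊢
    rw [e1, e2]
    exact Finset.sum_congr rfl fun t ht => hatom t (hS ht)
  have hlim := hfi.tendsto_ae_condExp (ℱ := countableFiltration Ω) (by
    rw [iSup_countableFiltration]
    exact hfm.stronglyMeasurable)
  filter_upwards [hlim, ae_all_iff.2 hc] with w h1 h2
  exact h1.congr fun k => (h2 k).symm

end Representation

/-! ### Riesz representation for `L^p(μ; X)` with `X` reflexive -/

section Riesz

variable {Ω : Type*} [MeasurableSpace Ω] {μ : Measure Ω} [IsFiniteMeasure μ]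
  [CountablyGenerated Ω] {X : Type*} [NormedAddCommGroup X] [NormedSpace ℝ X] {p q : ℝ}

/-- Strong measurability of a function with values in a separable subspace of a dual space. -/
theorem aestronglyMeasurable_of_forall_apply {Ω : Type*} [MeasurableSpace Ω] {μ : Measure Ω}
    (Y : Submodule ℝ (StrongDual ℝ X))
    (hY : TopologicalSpace.IsSeparable (Y : Set (StrongDual ℝ X))) {h : Ω → StrongDual ℝ X}
    (hmem : ∀ w, h w ∈ Y) {f : X → Ω → ℝ} (hfm : ∀ x, Measurable (f x))
    (hf : ∀ x, ∀ᵐ w ∂μ, h w x = f x w) : AEStronglyMeasurable h μ := by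
  obtain ⟨D, hD, hnorm⟩ := exists_norming_seq hY
  have hae : ∀ᵐ w ∂μ, ∀ x ∈ D, h w x = f x w := (ae_ball_iff hD).2 fun x _ => hf x
  -- The exceptional set may fail to be measurable, so it is enlarged to a measurable null set;
  -- setting `h` to `0` there keeps its values in the subspace `Y`.
  set N := toMeasurable μ {w | ¬ ∀ x ∈ D, h w x = f x w} with hN
  have hN0 : μ N = 0 := (measure_toMeasurable _).trans hae
  have hNm : MeasurableSet N := measurableSet_toMeasurable _ _
  have hNf : ∀ w, w ∉ N → ∀ x ∈ D, h w x = f x w := fun w hw => by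
    by_contra hc
    exact hw (subset_toMeasurable _ _ hc)
  have hmem' : ∀ w, Nᶜ.indicator h w ∈ Y := fun w => by
    by_cases hw : w ∈ N <;> simp [hw, hmem w]
  refine ⟨Nᶜ.indicator h, stronglyMeasurable_of_measurable_dist hY hmem' fun y hy => ?_, ?_⟩
  · refine measurable_of_Iic fun r => ?_
    rcases lt_or_ge r 0 with hr | hr
    · convert! MeasurableSet.empty
      ext w
      simpa using hr.trans_le dist_nonneg
    -- Differences of elements of `Y` are normed by the countable set `D`, so a bound on the
    -- distance is a countable family of scalar conditions.
    · have : (fun w => dist (Nᶜ.indicator h w) y) ⁻¹' Set.Iic r =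
          ⋂ x ∈ D, {w | |Nᶜ.indicator (f x) w - y x| ≤ r} := by
        ext w
        simp only [Set.mem_preimage, Set.mem_Iic, Set.mem_iInter, Set.mem_ofPred_eq]
        rw [dist_eq_norm, hnorm _ (Y.sub_mem (hmem' w) hy) r hr]
        refine forall₂_congr fun x hx => ?_
        by_cases hw : w ∈ N
        · simp [hw]
        · simp [hw, hNf w hw x hx]
      rw [this]
      refine MeasurableSet.biInter hD fun x _ => measurableSet_le ?_ measurable_const
      exact (((hfm x).indicator hNm.compl).sub_const _).abs
  · filter_upwards [compl_mem_ae_iff.2 hN0] with w hw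
    rw [Set.indicator_of_mem hw]

/-- A functional on `L^p(μ; X)`, with `X` reflexive, has a density in `L^q(μ; X*)`. -/
theorem exists_density (hX : Function.Surjective (NormedSpace.inclusionInDoubleDual ℝ X))
    [Fact (1 ≤ ENNReal.ofReal p)] (hpq : p.HolderConjugate q)
    (l : StrongDual ℝ (Lp X (ENNReal.ofReal p) μ)) :
    ∃ h : Ω → StrongDual ℝ X, AEStronglyMeasurable h μ ∧
      eLpNorm h (ENNReal.ofReal q) μ ≤ ‖l‖ₑ ∧
      ∀ x s (hs : MeasurableSet s), ∫ w in s, h w x ∂μ = l (indicatorCLM μ X _ hs x) := by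
  classical
  have hq := hpq.symm.pos
  choose f hfm hfi hf using exists_scalar_density l
  set g : ℕ → Ω → StrongDual ℝ X := fun k w => atomAverage l k (atomOf k w) with hg
  have hgm : ∀ k, Measurable fun w => ‖g k w‖ₑ := fun k =>
    ((stronglyMeasurable_comp_atomOf k fun s => ‖atomAverage l k s‖ₑ).mono
      ((countableFiltration Ω).le k)).measurable
  set C : Ω → ℝ≥0∞ := fun w => liminf (fun k => ‖g k w‖ₑ) atTop with hC
  -- Fatou's lemma, after the increasing bijection `a ↦ a ^ q` is moved through the lower limit.
  have hCint : ∫⁻ w, C w ^ q ∂μ ≤ ‖l‖ₑ ^ q := by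
    have e : ∀ w, C w ^ q = liminf (fun k => ‖g k w‖ₑ ^ q) atTop := fun w =>
      (ENNReal.orderIsoRpow q hq).liminf_apply
    rw [lintegral_congr e]
    refine (lintegral_liminf_le fun k => (hgm k).pow_const q).trans ?_
    refine (liminf_le_liminf (Eventually.of_forall fun k => lintegral_atomAverage_le hpq l k)).trans ?_
    simp
  have hCm : Measurable C := Measurable.liminf hgm
  have hCfin : ∀ᵐ w ∂μ, C w ≠ ∞ := by
    have := ae_lt_top (hCm.pow_const q) (hCint.trans_lt (by finiteness)).ne
    filter_upwards [this] with w hw hinf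
    rw [hinf, ENNReal.top_rpow_of_pos hq] at hw
    exact lt_irrefl _ hw
  have hex : ∀ w, ∃ z : StrongDual ℝ X, ‖z‖ₑ ≤ C w ∧ (C w ≠ ∞ →
      ∀ x c, Tendsto (fun k => g k w x) atTop (𝓝 c) → z x = c) ∧ (C w = ∞ → z = 0) := by
    intro w
    by_cases hw : C w = ∞
    · exact ⟨0, by rw [hw]; exact le_top, fun h => absurd hw h, fun _ => rfl⟩
    · obtain ⟨z, hz1, hz2⟩ := exists_weakStar_cluster _ hw
      exact ⟨z, hz1, fun _ => hz2, fun h => absurd h hw⟩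
  choose h hh1 hh2 hh3 using hex
  -- The null set depends on `x`; this is harmless because measurability will use only countably
  -- many `x`.
  have hhf : ∀ x, ∀ᵐ w ∂μ, h w x = f x w := fun x => by
    filter_upwards [hCfin, ae_tendsto_atomAverage_apply l x (hfm x) (hfi x) (hf x)] with w hw1 hw2
    exact hh2 w hw1 x _ hw2
  set A : Set (StrongDual ℝ X) :=
    Set.range fun s : (k : ℕ) × countablePartition Ω k => atomAverage l s.1 s.2 with hA
  set Y := (Submodule.span ℝ A).topologicalClosure with hYdef
  have hgY : ∀ k w, g k w ∈ Y := fun k w =>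
    Submodule.le_topologicalClosure _ (Submodule.subset_span ⟨⟨k, atomOf k w⟩, rfl⟩)
  have hYsep : TopologicalSpace.IsSeparable (Y : Set (StrongDual ℝ X)) :=
    ((Set.countable_range _).isSeparable.span (R := ℝ)).closure
  have hhY : ∀ w, h w ∈ Y := by
    intro w
    by_cases hw : C w = ∞
    · rw [hh3 w hw]; exact Y.zero_mem
    -- If `x` is annihilated by `Y`, then `g k w x = 0` for all `k`, so the cluster point vanishes
    -- at `x` as well.
    · refine mem_of_forall_apply_eq_zero hX Y (Submodule.isClosed_topologicalClosure _)
        fun x hx => hh2 w hw x 0 ?_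
      simp [hx _ (hgY _ w)]
  refine ⟨h, aestronglyMeasurable_of_forall_apply Y hYsep hhY hfm hhf, ?_, fun x s hs => ?_⟩
  · rw [eLpNorm_eq_lintegral_rpow_enorm_toReal (by simpa using hq) ENNReal.ofReal_ne_top,
      ENNReal.toReal_ofReal hq.le]
    calc (∫⁻ w, ‖h w‖ₑ ^ q ∂μ) ^ (1 / q) ≤ (‖l‖ₑ ^ q) ^ (1 / q) := by
          gcongr
          exact (lintegral_mono fun w => by gcongr; exact hh1 w).trans hCint
      _ = ‖l‖ₑ := by rw [← ENNReal.rpow_mul, mul_one_div_cancel hq.ne', ENNReal.rpow_one]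
  · rw [← hf x s hs]
    exact setIntegral_congr_ae hs ((hhf x).mono fun w hw _ => hw)

/-- **Riesz representation** for the dual of `L^p(μ; X)` with `X` reflexive. -/
theorem exists_representation (hX : Function.Surjective (NormedSpace.inclusionInDoubleDual ℝ X))
    [Fact (1 ≤ ENNReal.ofReal p)] (hpq : p.HolderConjugate q)
    (l : StrongDual ℝ (Lp X (ENNReal.ofReal p) μ)) :
    ∃ h : Ω → StrongDual ℝ X, AEStronglyMeasurable h μ ∧
      eLpNorm h (ENNReal.ofReal q) μ ≤ ‖l‖ₑ ∧ ∀ f, l f = ∫ w, h w (f w) ∂μ := by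
  obtain ⟨h, hm, hn, hrep⟩ := exists_density hX hpq l
  refine ⟨h, hm, hn, ?_⟩
  have hmem : MemLp h (ENNReal.ofReal q) μ := ⟨hm, hn.trans_lt (by finiteness)⟩
  have : Fact (1 ≤ ENNReal.ofReal q) := ⟨by simpa using hpq.symm.lt.le⟩
  have : ENNReal.HolderConjugate (ENNReal.ofReal q) (ENNReal.ofReal p) := hpq.symm.ennrealOfReal
  -- Hölder makes the integral pairing a continuous functional, so comparison with `l` reduces to
  -- indicators by density.
  set B := (ContinuousLinearMap.id ℝ (StrongDual ℝ X)).lpPairing μ (ENNReal.ofReal q)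
    (ENNReal.ofReal p) (hmem.toLp h) with hB
  have hBf : ∀ f, B f = ∫ w, h w (f w) ∂μ := fun f => by
    rw [hB, ContinuousLinearMap.lpPairing_eq_integral]
    refine integral_congr_ae ?_
    filter_upwards [hmem.coeFn_toLp] with w hw
    simp [hw]
  intro f
  rw [← hBf]
  refine Lp.induction ENNReal.ofReal_ne_top (motive := fun f => l f = B f) (fun c s hs hμs => ?_)
    (fun f g hf hg _ h1 h2 => ?_) (isClosed_eq l.continuous B.continuous) f
  · rw [Lp.simpleFunc.coe_indicatorConst]
    change l (indicatorCLM μ X _ hs c) = B (indicatorCLM μ X _ hs c)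
    rw [hBf, ← hrep c _ hs, ← integral_indicator hs]
    refine integral_congr_ae ?_
    filter_upwards [coeFn_indicatorCLM (μ := μ) (ENNReal.ofReal p) hs c] with w hw
    rw [hw]
    by_cases hws : w ∈ s <;> simp [hws]
  · rw [map_add, map_add, h1, h2]

end Riesz

/-! ### Measure and disjointness of dyadic cubes -/

section Cubes

variable {n : ℕ}

lemma measurableSet_cube (i : CubeIndex n) : MeasurableSet (cube i) := by
  rw [cube_eq_preimage]
  exact (MeasurableSet.univ_pi fun _ => measurableSet_Ico).preimage
    (PiLp.volume_preserving_ofLp (Fin n)).measurable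

lemma volume_cube_eq_rpow (i : CubeIndex n) : volume (cube i) = (2 : ℝ≥0∞) ^ (-(i.1 * n) : ℝ) := by
  have h : ENNReal.ofReal ((2 : ℝ) ^ (-i.1)) = (2 : ℝ≥0∞) ^ (-(i.1 : ℝ)) := by
    rw [← Real.rpow_intCast, ← ENNReal.ofReal_rpow_of_pos two_pos, Int.cast_neg]
    simp
  rw [volume_cube, h, ← ENNReal.rpow_natCast, ← ENNReal.rpow_mul, neg_mul]

lemma volume_cube_ne_zero (i : CubeIndex n) : volume (cube i) ≠ 0 := by
  rw [volume_cube_eq_rpow]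
  exact (ENNReal.rpow_pos two_pos (by simp)).ne'

lemma volume_cube_ne_top (i : CubeIndex n) : volume (cube i) ≠ ∞ := by
  rw [volume_cube_eq_rpow]
  exact ENNReal.rpow_ne_top_of_ne_zero (by simp) (by simp)

lemma volume_cube_rpow_ne_zero (i : CubeIndex n) (a : ℝ) : volume (cube i) ^ a ≠ 0 :=
  (ENNReal.rpow_pos (pos_iff_ne_zero.2 (volume_cube_ne_zero i)) (volume_cube_ne_top i)).ne'

lemma volume_cube_rpow_ne_top (i : CubeIndex n) (a : ℝ) : volume (cube i) ^ a ≠ ∞ :=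
  ENNReal.rpow_ne_top_of_ne_zero (volume_cube_ne_zero i) (volume_cube_ne_top i)

instance (i : CubeIndex n) : IsFiniteMeasure (volume.restrict (cube i)) :=
  ⟨by simpa using (volume_cube_ne_top i).lt_top⟩

lemma disjoint_cube (j : ℤ) :
    Pairwise (Function.onFun Disjoint fun m : Fin n → ℤ => cube (j, m)) := by
  intro m m' hne
  refine Set.disjoint_left.2 fun x hx hx' => hne (funext fun k => ?_)
  have h2 : (0 : ℝ) < 2 ^ (-j) := by positivity
  obtain ⟨h1, h1'⟩ := hx k
  obtain ⟨h3, h3'⟩ := hx' k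
  have a := lt_of_mul_lt_mul_left (h1.trans_lt h3') h2.le
  have b := lt_of_mul_lt_mul_left (h3.trans_lt h1') h2.le
  norm_cast at a b
  dsimp only at a b
  lia

lemma tsum_volume_inter_cube_le (Q : Set (EuclideanSpace ℝ (Fin n))) (hQ : MeasurableSet Q) (j : ℤ) :
    ∑' m : Fin n → ℤ, volume (Q ∩ cube (j, m)) ≤ volume Q := by
  rw [← measure_iUnion (fun m m' h => ((disjoint_cube j) h).mono Set.inter_subset_right
    Set.inter_subset_right) fun m => hQ.inter (measurableSet_cube _)]
  exact measure_mono (Set.iUnion_subset fun _ => Set.inter_subset_left)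

lemma ae_of_forall_unit_cube {P : EuclideanSpace ℝ (Fin n) → Prop}
    (h : ∀ m : Fin n → ℤ, ∀ᵐ x ∂volume.restrict (cube ((0 : ℤ), m)), P x) : ∀ᵐ x, P x := by
  rw [← Measure.restrict_univ (μ := volume), ← iUnion_unit_cube, ae_restrict_iUnion_iff]
  exact h

end Cubes

/-! ### Finite Morrey norm of indicators of unit cubes -/

section MorreyIndicator

variable {n : ℕ} {p t r : ℝ}

lemma morreyENorm_mono {Y Z : Type*} [NormedAddCommGroup Y] [NormedAddCommGroup Z] (hr : 1 < r)
    {f : EuclideanSpace ℝ (Fin n) → Y} {g : EuclideanSpace ℝ (Fin n) → Z}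
    (h : ∀ x, ‖f x‖ ≤ ‖g x‖) : morreyENorm p t r f ≤ morreyENorm p t r g := by
  have hr0 : 0 < r := by linarith
  unfold morreyENorm
  gcongr with i
  exact eLpNorm_mono h

lemma tsum_geometric_rpow_lt_top {c : ℝ} (hc : 0 < c) :
    ∑' k : ℕ, (2 : ℝ≥0∞) ^ (-(c * k)) < ∞ := by
  have : ∀ k : ℕ, (2 : ℝ≥0∞) ^ (-(c * k)) = ((2 : ℝ≥0∞) ^ (-c)) ^ k := fun k => by
    rw [← ENNReal.rpow_natCast, ← ENNReal.rpow_mul, neg_mul]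
  simp only [this]
  rw [ENNReal.tsum_geometric, ENNReal.inv_lt_top, tsub_pos_iff_lt]
  exact ENNReal.rpow_lt_one_of_one_lt_of_neg (by norm_num) (by linarith)

/-- Indicators of unit dyadic cubes lie in the Bourgain-Morrey space. -/
theorem morreyENorm_indicator_cube_lt_top (hn : 1 ≤ n) (hp : 1 < p) (hpt : p < t) (htr : t < r)
    (m : Fin n → ℤ) :
    morreyENorm p t r ((cube ((0 : ℤ), m)).indicator fun _ => (1 : ℝ)) < ∞ := by
  have hp0 : 0 < p := by linarith
  have ht0 : 0 < t := by linarith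
  have hr0 : 0 < r := by linarith
  have hn0 : (0 : ℝ) < n := by exact_mod_cast hn
  set Q := cube ((0 : ℤ), m) with hQ
  have hQm : MeasurableSet Q := measurableSet_cube _
  have hQ1 : volume Q = 1 := by rw [hQ, volume_cube_eq_rpow]; simp
  have hrp : 1 ≤ r / p := by rw [one_le_div hp0]; linarith
  -- One power of `|Q ∩ Q_i|` is kept for summation within a generation. The remaining power `r / p
  -- - 1` is bounded by `1`, good for large cubes, or by the power of `|Q_i|`, good for small ones.
  have hterm : ∀ i : CubeIndex n, (volume (cube i) ^ (1 / t - 1 / p) *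
      eLpNorm (Q.indicator fun _ => (1 : ℝ)) (ENNReal.ofReal p) (volume.restrict (cube i))) ^ r ≤
      min (volume (cube i) ^ (r / t - r / p)) (volume (cube i) ^ (r / t - 1)) *
        volume (Q ∩ cube i) := by
    intro i
    have h0 := volume_cube_ne_zero i
    have h1 := volume_cube_ne_top i
    rw [eLpNorm_indicator_const hQm (by simpa using hp0) ENNReal.ofReal_ne_top, enorm_one, one_mul,
      Measure.restrict_apply hQm, ENNReal.toReal_ofReal hp0.le, ENNReal.mul_rpow_of_nonneg _ _ hr0.le,
      ← ENNReal.rpow_mul, ← ENNReal.rpow_mul]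
    have e1 : (1 / t - 1 / p) * r = r / t - r / p := by ring
    have e2 : 1 / p * r = (r / p - 1) + 1 := by ring
    rw [e1, e2, ENNReal.rpow_add_of_nonneg _ _ (by linarith) zero_le_one, ENNReal.rpow_one,
      ← mul_assoc]
    gcongr
    refine le_min ?_ ?_
    · refine mul_le_of_le_one_right (zero_le) (ENNReal.rpow_le_one ?_ (by linarith))
      exact (measure_mono Set.inter_subset_left).trans hQ1.le
    · have e3 : r / t - 1 = (r / t - r / p) + (r / p - 1) := by ring
      rw [e3, ENNReal.rpow_add _ _ h0 h1]
      gcongr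
      exact Set.inter_subset_right
  unfold morreyENorm
  refine ENNReal.rpow_lt_top_of_nonneg (by positivity) (ne_of_lt ?_)
  refine (ENNReal.tsum_le_tsum hterm).trans_lt ?_
  rw [ENNReal.tsum_prod']
  have hlevel : ∀ j : ℤ, ∑' m' : Fin n → ℤ,
      min (volume (cube (j, m')) ^ (r / t - r / p)) (volume (cube (j, m')) ^ (r / t - 1)) *
        volume (Q ∩ cube (j, m')) ≤
      min ((2 : ℝ≥0∞) ^ (-(j * n * (r / t - r / p)))) ((2 : ℝ≥0∞) ^ (-(j * n * (r / t - 1)))) := by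
    intro j
    simp only [volume_cube_eq_rpow, ← ENNReal.rpow_mul, neg_mul]
    rw [ENNReal.tsum_mul_left]
    refine mul_le_of_le_one_right zero_le ?_
    exact (tsum_volume_inter_cube_le Q hQm j).trans hQ1.le
  refine (ENNReal.tsum_le_tsum hlevel).trans_lt ?_
  -- Both halves are geometric: levels `j ≥ 0` decay at rate `n (r/t - 1)`, positive by `t < r`, and
  -- levels `j < 0` at rate `n (r/p - r/t)`, positive by `p < t`.
  rw [tsum_of_nat_of_neg_add_one ENNReal.summable ENNReal.summable, ENNReal.add_lt_top]
  have hc1 : 0 < n * (r / t - 1) := mul_pos hn0 (by rw [sub_pos, one_lt_div ht0]; exact htr)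
  have hc2 : 0 < n * (r / p - r / t) := mul_pos hn0 (sub_pos.2 (by gcongr))
  constructor
  · refine lt_of_le_of_lt (ENNReal.tsum_le_tsum fun k => ?_) (tsum_geometric_rpow_lt_top hc1)
    refine (min_le_right _ _).trans (le_of_eq ?_)
    congr 1
    push_cast
    ring
  · refine lt_of_le_of_lt (ENNReal.tsum_le_tsum fun k => ?_) (tsum_geometric_rpow_lt_top hc2)
    -- The level is `-(k + 1)`, so there is one decay factor to spare, which monotonicity discards.
    refine (min_le_left _ _).trans (ENNReal.rpow_le_rpow_of_exponent_le (by norm_num) ?_)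
    push_cast
    nlinarith

/-- Bounded multiples of indicators of subsets of a unit cube lie in the Bourgain-Morrey space. -/
theorem morreyENorm_indicator_const_lt_top {X : Type*} [NormedAddCommGroup X] (hn : 1 ≤ n)
    (hp : 1 < p) (hpt : p < t) (htr : t < r) (m : Fin n → ℤ)
    {A : Set (EuclideanSpace ℝ (Fin n))} (hA : A ⊆ cube ((0 : ℤ), m)) (x : X) :
    morreyENorm p t r (A.indicator fun _ => x) < ∞ := by
  have hr : 1 < r := by linarith
  refine (morreyENorm_mono (g := ‖x‖ • (cube ((0 : ℤ), m)).indicator fun _ => (1 : ℝ)) hr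
    fun y => ?_).trans_lt ?_
  · by_cases hy : y ∈ A
    · simp [hy, hA hy]
    · simpa [hy] using mul_nonneg (norm_nonneg x) (abs_nonneg _)
  · rw [morreyENorm_const_smul hr]
    exact ENNReal.mul_lt_top enorm_lt_top (morreyENorm_indicator_cube_lt_top hn hp hpt htr m)

end MorreyIndicator

/-! ### Hölder estimates for blocks and convergence of block series -/

section Pairing

variable {n : ℕ} {p t r : ℝ} {Y Z : Type*} [NormedAddCommGroup Y] [NormedAddCommGroup Z]

/-- Thanks to this identity the size bound of a block is exactly the Morrey weight of its cube. -/
lemma conjExponent_inv_sub_inv (hp : 1 < p) (ht : 1 < t) :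
    1 / p.conjExponent - 1 / t.conjExponent = 1 / t - 1 / p := by
  have h1 := (Real.HolderConjugate.conjExponent hp).inv_add_inv_eq_one
  have h2 := (Real.HolderConjugate.conjExponent ht).inv_add_inv_eq_one
  simp only [one_div]
  linarith

lemma tsum_mul_le_rpow_mul_rpow {ι : Type*} [Countable ι] {q r : ℝ} (h : q.HolderConjugate r)
    (a b : ι → ℝ≥0∞) :
    ∑' i, a i * b i ≤ (∑' i, a i ^ q) ^ (1 / q) * (∑' i, b i ^ r) ^ (1 / r) := by
  let _ : MeasurableSpace ι := ⊤
  have := ENNReal.lintegral_mul_le_Lp_mul_Lq Measure.count h (f := a) (g := b)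
    (Measurable.of_discrete.aemeasurable) (Measurable.of_discrete.aemeasurable)
  simpa [lintegral_count] using this

/-- Hölder on the supporting cube: the `L^{p'}` bound of the block supplies the weight, and what
results is the term of the cube in the Morrey norm of `f`. -/
lemma lintegral_block_mul_le (hp : 1 < p) (ht : 1 < t) {i : CubeIndex n}
    {b : EuclideanSpace ℝ (Fin n) → Y} (hb : IsBlock p.conjExponent t.conjExponent (cube i) b)
    {f : EuclideanSpace ℝ (Fin n) → Z} (hf : AEStronglyMeasurable f volume) :
    ∫⁻ x, ‖b x‖ₑ * ‖f x‖ₑ ≤ volume (cube i) ^ (1 / t - 1 / p) *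
      eLpNorm f (ENNReal.ofReal p) (volume.restrict (cube i)) := by
  have hpc := (Real.HolderConjugate.conjExponent hp).symm
  have hp0 := hpc.symm.pos
  have hs : ∫⁻ x, ‖b x‖ₑ * ‖f x‖ₑ = ∫⁻ x in cube i, ‖b x‖ₑ * ‖f x‖ₑ := by
    rw [← lintegral_indicator (measurableSet_cube i)]
    refine lintegral_congr fun x => ?_
    by_cases hx : x ∈ cube i
    · simp [hx]
    · simp [hx, hb.support x hx]
  have hB := hb.eLpNorm_le
  rw [conjExponent_inv_sub_inv hp ht] at hB
  rw [hs]
  refine (ENNReal.lintegral_mul_le_Lp_mul_Lq (volume.restrict (cube i)) hpc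
    hb.aestronglyMeasurable.restrict.enorm hf.restrict.enorm).trans ?_
  rw [eLpNorm_eq_lintegral_rpow_enorm_toReal (by simpa using hp0) ENNReal.ofReal_ne_top,
    ENNReal.toReal_ofReal hp0.le]
  gcongr
  rw [eLpNorm_eq_lintegral_rpow_enorm_toReal (by simpa using hpc.pos) ENNReal.ofReal_ne_top,
    ENNReal.toReal_ofReal hpc.pos.le] at hB
  refine le_trans ?_ hB
  have := hpc.pos
  gcongr
  exact Measure.restrict_le_self

/-- Hölder's inequality between blocks and the Bourgain-Morrey norm. -/
theorem lintegral_tsum_block_le (hp : 1 < p) (ht : 1 < t) (hr : 1 < r) (l : CubeIndex n → ℝ)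
    {b : CubeIndex n → EuclideanSpace ℝ (Fin n) → Y}
    (hb : ∀ i, IsBlock p.conjExponent t.conjExponent (cube i) (b i))
    {f : EuclideanSpace ℝ (Fin n) → Z} (hf : AEStronglyMeasurable f volume) :
    ∑' i, ∫⁻ x, ‖l i‖ₑ * (‖b i x‖ₑ * ‖f x‖ₑ) ≤
      (∑' i, ‖l i‖ₑ ^ r.conjExponent) ^ (1 / r.conjExponent) * morreyENorm p t r f := by
  refine le_trans (ENNReal.tsum_le_tsum fun i => ?_)
    (tsum_mul_le_rpow_mul_rpow (Real.HolderConjugate.conjExponent hr).symm _ _)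
  rw [lintegral_const_mul' _ _ enorm_ne_top]
  gcongr
  exact lintegral_block_mul_le hp ht (hb i) hf

lemma tsum_enorm_rpow_eq {ι : Type*} {u : ℝ} (hu : 1 < u) {l : ι → ℝ}
    (hl : Summable fun i => |l i| ^ u) :
    (∑' i, ‖l i‖ₑ ^ u) ^ (1 / u) = ENNReal.ofReal ((∑' i, |l i| ^ u) ^ (1 / u)) := by
  have hu0 : 0 < u := by linarith
  rw [← ENNReal.ofReal_rpow_of_nonneg (tsum_nonneg fun i => by positivity) (by positivity),
    ENNReal.ofReal_tsum_of_nonneg (fun i => by positivity) hl]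
  congr 1
  refine tsum_congr fun i => ?_
  rw [Real.enorm_eq_ofReal_abs, ENNReal.ofReal_rpow_of_nonneg (abs_nonneg _) hu0.le]

/-- Block series with `ℓ^{r'}` coefficients converge absolutely almost everywhere. -/
theorem ae_summable_norm_blocks (hn : 1 ≤ n) (hp : 1 < p) (hpt : p < t) (htr : t < r)
    {l : CubeIndex n → ℝ} (hl : Summable fun i => |l i| ^ r.conjExponent)
    {b : CubeIndex n → EuclideanSpace ℝ (Fin n) → Y}
    (hb : ∀ i, IsBlock p.conjExponent t.conjExponent (cube i) (b i)) :
    ∀ᵐ x, Summable fun i => |l i| * ‖b i x‖ := by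
  have ht : 1 < t := by linarith
  have hr : 1 < r := by linarith
  have hrc := (Real.HolderConjugate.conjExponent hr).symm
  refine ae_of_forall_unit_cube fun m => ?_
  -- Paired with the indicator of a unit cube, the block estimate bounds the integral over that cube
  -- of the sum of the norms.
  set f : EuclideanSpace ℝ (Fin n) → ℝ := (cube ((0 : ℤ), m)).indicator fun _ => (1 : ℝ) with hf
  have hfm : AEStronglyMeasurable f volume :=
    (stronglyMeasurable_const.indicator (measurableSet_cube _)).aestronglyMeasurable
  have h := lintegral_tsum_block_le hp ht hr l hb hfm
  rw [tsum_enorm_rpow_eq hrc.lt hl] at h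
  have hmeas : ∀ i, AEMeasurable (fun x => ‖l i‖ₑ * (‖b i x‖ₑ * ‖f x‖ₑ)) volume := fun i =>
    ((hb i).aestronglyMeasurable.enorm.mul hfm.enorm).const_mul _
  rw [← lintegral_tsum hmeas] at h
  have hfin := ae_lt_top' (AEMeasurable.tsum hmeas) (h.trans_lt (ENNReal.mul_lt_top
    ENNReal.ofReal_lt_top (morreyENorm_indicator_cube_lt_top hn hp hpt htr m))).ne
  filter_upwards [ae_restrict_of_ae hfin, ae_restrict_mem (measurableSet_cube _)] with x hx hxm
  have h1 : ‖f x‖ₑ = 1 := by simp [hf, hxm]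
  simp only [h1, mul_one] at hx
  refine (ENNReal.summable_toReal hx.ne).congr fun i => ?_
  simp

end Pairing

/-! ### Termwise integration of block series -/

section DualPairing

variable {n : ℕ} {p t r : ℝ} {X : Type*} [NormedAddCommGroup X] [NormedSpace ℝ X]

/-- A function with a block decomposition pairs with the Bourgain-Morrey space, and the pairing may
be computed block by block. -/
theorem IsDecomposition.pairing (hp : 1 < p) (ht : 1 < t) (hr : 1 < r)
    {g : EuclideanSpace ℝ (Fin n) → StrongDual ℝ X} {l : CubeIndex n → ℝ}
    {b : CubeIndex n → EuclideanSpace ℝ (Fin n) → StrongDual ℝ X}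
    (hg : AEStronglyMeasurable g volume)
    (h : IsDecomposition p.conjExponent t.conjExponent r.conjExponent g l b)
    {f : EuclideanSpace ℝ (Fin n) → X} (hf : AEStronglyMeasurable f volume)
    (hfin : morreyENorm p t r f < ∞) :
    Integrable (fun x => g x (f x)) ∧
      ‖∫ x, g x (f x)‖ ≤ (∑' i, |l i| ^ r.conjExponent) ^ (1 / r.conjExponent) *
        (morreyENorm p t r f).toReal ∧
      HasSum (fun i => ∫ x, (l i • b i x) (f x)) (∫ x, g x (f x)) := by
  have hrc := (Real.HolderConjugate.conjExponent hr).symm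
  have hbound := lintegral_tsum_block_le hp ht hr l h.isBlock hf
  rw [tsum_enorm_rpow_eq hrc.lt h.summable] at hbound
  set K := (∑' i, |l i| ^ r.conjExponent) ^ (1 / r.conjExponent) with hK
  have hK0 : 0 ≤ K := by positivity
  have hKfin : ENNReal.ofReal K * morreyENorm p t r f < ∞ :=
    ENNReal.mul_lt_top ENNReal.ofReal_lt_top hfin
  have hFm : ∀ i, AEStronglyMeasurable (fun x => (l i • b i x) (f x)) volume := fun i =>
    (ContinuousLinearMap.id ℝ (StrongDual ℝ X)).aestronglyMeasurable_comp₂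
      ((h.isBlock i).aestronglyMeasurable.const_smul (l i)) hf
  have hFle : ∀ i x, ‖(l i • b i x) (f x)‖ₑ ≤ ‖l i‖ₑ * (‖b i x‖ₑ * ‖f x‖ₑ) := fun i x => by
    rw [smul_apply, enorm_smul]
    gcongr
    exact (b i x).le_opENorm _
  -- This single absolute bound gives integrability of each term and of the sum, the norm estimate,
  -- and the exchange of sum and integral.
  have hFsum : ∑' i, ∫⁻ x, ‖(l i • b i x) (f x)‖ₑ ≤ ENNReal.ofReal K * morreyENorm p t r f :=
    (ENNReal.tsum_le_tsum fun i => lintegral_mono (hFle i)).trans hbound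
  have hFi : ∀ i, Integrable (fun x => (l i • b i x) (f x)) volume := fun i =>
    ⟨hFm i, (ENNReal.le_tsum i).trans_lt (hFsum.trans_lt hKfin)⟩
  have hsum : ∀ᵐ x, HasSum (fun i => (l i • b i x) (f x)) (g x (f x)) := by
    filter_upwards [h.hasSum] with x hx
    exact hx.mapL (ContinuousLinearMap.apply ℝ ℝ (f x))
  have hgm : AEStronglyMeasurable (fun x => g x (f x)) volume :=
    (ContinuousLinearMap.id ℝ (StrongDual ℝ X)).aestronglyMeasurable_comp₂ hg hf
  have hgle : ∫⁻ x, ‖g x (f x)‖ₑ ≤ ENNReal.ofReal K * morreyENorm p t r f := by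
    refine le_trans ?_ hFsum
    rw [← lintegral_tsum fun i => (hFm i).enorm]
    refine lintegral_mono_ae ?_
    filter_upwards [hsum] with x hx
    rw [← hx.tsum_eq]
    exact enorm_tsum_le_tsum_enorm
  refine ⟨⟨hgm, hgle.trans_lt hKfin⟩, ?_, ?_⟩
  · have := (enorm_integral_le_lintegral_enorm (μ := volume) fun x => g x (f x)).trans hgle
    have := ENNReal.toReal_mono hKfin.ne this
    rwa [toReal_enorm, ENNReal.toReal_mul, ENNReal.toReal_ofReal hK0] at this
  · have h1 := hasSum_integral_of_summable_integral_norm hFi (by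
      have := ENNReal.summable_toReal (hFsum.trans_lt hKfin).ne
      refine this.congr fun i => ?_
      rw [integral_norm_eq_lintegral_enorm (hFm i)])
    rwa [integral_congr_ae (hsum.mono fun x hx => hx.tsum_eq)] at h1

end DualPairing

instance (p : ℝ) [hp : Fact (1 < p)] : Fact (1 ≤ ENNReal.ofReal p) :=
  ⟨by simpa using hp.out.le⟩

/-! ### Isometric embedding of the Morrey space into `ℓ^r(L^p(Q; X))` -/

section Embedding

variable {n : ℕ} {p t r : ℝ} [hp : Fact (1 < p)] [hr : Fact (1 < r)]
  {X : Type*} [NormedAddCommGroup X] [NormedSpace ℝ X]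

lemma MorreySpace.tsum_ne_top (f : MorreySpace n X p t r) :
    ∑' i : CubeIndex n, (volume (cube i) ^ (1 / t - 1 / p) *
      eLpNorm f.1 (ENNReal.ofReal p) (volume.restrict (cube i))) ^ r ≠ ∞ := fun h => by
  have hf : morreyENorm p t r f.1 < ∞ := f.2
  have hr0 : 0 < 1 / r := one_div_pos.2 (by linarith [hr.out])
  rw [morreyENorm, h, ENNReal.top_rpow_of_pos hr0] at hf
  exact lt_irrefl _ hf

lemma MorreySpace.memLp (f : MorreySpace n X p t r) (i : CubeIndex n) :
    MemLp f.1 (ENNReal.ofReal p) (volume.restrict (cube i)) := by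
  refine ⟨f.1.aestronglyMeasurable.restrict, lt_top_iff_ne_top.2 fun h => ?_⟩
  have h1 := ENNReal.ne_top_of_tsum_ne_top (MorreySpace.tsum_ne_top f) i
  rw [h, ENNReal.mul_top (volume_cube_rpow_ne_zero i _),
    ENNReal.top_rpow_of_pos (by linarith [hr.out])] at h1
  exact h1 rfl

/-- The weight `|Q|^{1/t - 1/p}` of a dyadic cube. -/
noncomputable def cubeWeight (p t : ℝ) (i : CubeIndex n) : ℝ :=
  (volume (cube i) ^ (1 / t - 1 / p)).toReal

lemma enorm_cubeWeight (p t : ℝ) (i : CubeIndex n) :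
    ‖cubeWeight p t i‖ₑ = volume (cube i) ^ (1 / t - 1 / p) := by
  rw [cubeWeight, Real.enorm_eq_ofReal ENNReal.toReal_nonneg,
    ENNReal.ofReal_toReal (volume_cube_rpow_ne_top i _)]

/-- The weighted restriction of `f` to a dyadic cube. -/
noncomputable def MorreySpace.coord (f : MorreySpace n X p t r) (i : CubeIndex n) :
    Lp X (ENNReal.ofReal p) (volume.restrict (cube i)) :=
  cubeWeight p t i • (MorreySpace.memLp f i).toLp f.1

lemma MorreySpace.coeFn_coord (f : MorreySpace n X p t r) (i : CubeIndex n) :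
    MorreySpace.coord f i =ᵐ[volume.restrict (cube i)] fun x => cubeWeight p t i • f.1 x := by
  filter_upwards [Lp.coeFn_smul (cubeWeight p t i) ((MorreySpace.memLp f i).toLp f.1),
    (MorreySpace.memLp f i).coeFn_toLp] with x h1 h2
  rw [MorreySpace.coord, h1, Pi.smul_apply, h2]

lemma MorreySpace.norm_coord_rpow (f : MorreySpace n X p t r) (i : CubeIndex n) :
    ‖MorreySpace.coord f i‖ ^ r = ((volume (cube i) ^ (1 / t - 1 / p) *
      eLpNorm f.1 (ENNReal.ofReal p) (volume.restrict (cube i))) ^ r).toReal := by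
  rw [MorreySpace.coord, ← ENNReal.toReal_rpow, ← toReal_enorm, enorm_smul, enorm_cubeWeight,
    Lp.enorm_toLp]

/-- The family of weighted restrictions of `f` to the dyadic cubes, as an element of
`ℓ^r(L^p(Q; X))`. -/
noncomputable def MorreySpace.coords (f : MorreySpace n X p t r) :
    lp (fun i : CubeIndex n => Lp X (ENNReal.ofReal p) (volume.restrict (cube i)))
      (ENNReal.ofReal r) :=
  ⟨fun i => MorreySpace.coord f i, memℓp_gen (by
    rw [ENNReal.toReal_ofReal (by linarith [hr.out])]
    exact (ENNReal.summable_toReal (MorreySpace.tsum_ne_top f)).congr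
      fun i => (MorreySpace.norm_coord_rpow f i).symm)⟩

lemma MorreySpace.coords_apply (f : MorreySpace n X p t r) (i : CubeIndex n) :
    MorreySpace.coords f i = MorreySpace.coord f i := rfl

lemma MorreySpace.norm_coords (f : MorreySpace n X p t r) : ‖MorreySpace.coords f‖ = ‖f‖ := by
  have hr0 : 0 < r := by linarith [hr.out]
  change _ = (morreyENorm p t r f.1).toReal
  rw [lp.norm_eq_tsum_rpow (by rwa [ENNReal.toReal_ofReal hr0.le]), ENNReal.toReal_ofReal hr0.le,
    morreyENorm, ← ENNReal.toReal_rpow, ENNReal.tsum_toReal_eq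
      (fun i => ENNReal.ne_top_of_tsum_ne_top (MorreySpace.tsum_ne_top f) i)]
  simp only [MorreySpace.coords_apply, MorreySpace.norm_coord_rpow]

lemma MorreySpace.coord_add (f g : MorreySpace n X p t r) (i : CubeIndex n) :
    MorreySpace.coord (f + g) i = MorreySpace.coord f i + MorreySpace.coord g i := by
  refine Lp.ext ?_
  filter_upwards [MorreySpace.coeFn_coord (f + g) i, MorreySpace.coeFn_coord f i,
    MorreySpace.coeFn_coord g i, Lp.coeFn_add (MorreySpace.coord f i) (MorreySpace.coord g i),
    ae_restrict_of_ae (AEEqFun.coeFn_add f.1 g.1)] with x h1 h2 h3 h4 h5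
  rw [h1, h4, Pi.add_apply, h2, h3, ← smul_add]
  exact congrArg _ h5

lemma MorreySpace.coord_smul (c : ℝ) (f : MorreySpace n X p t r) (i : CubeIndex n) :
    MorreySpace.coord (c • f) i = c • MorreySpace.coord f i := by
  refine Lp.ext ?_
  filter_upwards [MorreySpace.coeFn_coord (c • f) i, MorreySpace.coeFn_coord f i,
    Lp.coeFn_smul c (MorreySpace.coord f i),
    ae_restrict_of_ae (AEEqFun.coeFn_smul c f.1)] with x h1 h2 h3 h4
  rw [h1, h3, Pi.smul_apply, h2, smul_comm c]
  exact congrArg _ h4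

variable (n p t r X) in
/-- The isometric embedding of the Bourgain-Morrey space into `ℓ^r(L^p(Q; X))`. -/
noncomputable def MorreySpace.embedding :
    MorreySpace n X p t r →ₗᵢ[ℝ]
      lp (fun i : CubeIndex n => Lp X (ENNReal.ofReal p) (volume.restrict (cube i)))
        (ENNReal.ofReal r) where
  toFun := MorreySpace.coords
  map_add' f g := lp.ext (funext fun i => MorreySpace.coord_add f g i)
  map_smul' c f := lp.ext (funext fun i => MorreySpace.coord_smul c f i)
  norm_map' := MorreySpace.norm_coords

end Embedding

/-! ### Representation of functionals by block series -/

section Surjectivity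

variable {n : ℕ} {p t r : ℝ} [hp : Fact (1 < p)] [hr : Fact (1 < r)]
  {X : Type*} [NormedAddCommGroup X] [NormedSpace ℝ X]

/-- Every functional on the Bourgain-Morrey space extends to `ℓ^r(L^p(Q; X))` without increasing
its norm. -/
theorem MorreySpace.exists_extension (L : StrongDual ℝ (MorreySpace n X p t r)) :
    ∃ M : StrongDual ℝ (lp (fun i : CubeIndex n =>
      Lp X (ENNReal.ofReal p) (volume.restrict (cube i))) (ENNReal.ofReal r)),
      ‖M‖ ≤ ‖L‖ ∧ ∀ f, M (MorreySpace.embedding n p t r X f) = L f := by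
  let T := MorreySpace.embedding n p t r X
  let e := T.equivRange
  obtain ⟨M, hM, hMn⟩ := exists_extension_norm_eq (LinearMap.range T.toLinearMap)
    (L ∘L (e.symm.toContinuousLinearEquiv : LinearMap.range T.toLinearMap →L[ℝ] _))
  refine ⟨M, ?_, fun f => ?_⟩
  · rw [hMn]
    refine ContinuousLinearMap.opNorm_le_bound _ (norm_nonneg _) fun y => ?_
    refine (L.le_opNorm _).trans_eq ?_
    congr 1
    exact e.symm.norm_map y
  · have := hM (e f)
    refine this.trans ?_
    change L (e.symm (e f)) = L f
    rw [e.symm_apply_apply]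

/-- The coordinate functionals of a functional on `ℓ^r(L^p(Q; X))` have `ℓ^{r'}` norm at most the
norm of the functional. -/
theorem sum_norm_coord_rpow_le (M : StrongDual ℝ (lp (fun i : CubeIndex n =>
      Lp X (ENNReal.ofReal p) (volume.restrict (cube i))) (ENNReal.ofReal r)))
    (s : Finset (CubeIndex n)) :
    ∑ i ∈ s, ‖M ∘L lp.singleContinuousLinearMap ℝ (fun i : CubeIndex n =>
      Lp X (ENNReal.ofReal p) (volume.restrict (cube i))) (ENNReal.ofReal r) i‖ ^ r.conjExponent ≤
      ‖M‖ ^ r.conjExponent := by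
  have hr0 : 0 < r := by linarith [hr.out]
  refine sum_norm_comp_rpow_le (Real.HolderConjugate.conjExponent hr.out) s M _ fun x => ?_
  have h := lp.norm_sum_single (p := ENNReal.ofReal r) (by rwa [ENNReal.toReal_ofReal hr0.le]) x s
  rw [ENNReal.toReal_ofReal hr0.le] at h
  simp only [lp.singleContinuousLinearMap_apply]
  rw [← h, ← Real.rpow_mul (norm_nonneg _), mul_one_div_cancel hr0.ne', Real.rpow_one]

/-- A function on a dyadic cube of `L^{p'}` norm at most `N`, normalized to be a block. -/
lemma isBlock_indicator {Y : Type*} [NormedAddCommGroup Y] [NormedSpace ℝ Y]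
    (ht : 1 < t) (i : CubeIndex n) {h : EuclideanSpace ℝ (Fin n) → Y}
    (hm : AEStronglyMeasurable h (volume.restrict (cube i))) {N : ℝ} (hN : 0 ≤ N)
    (hn : eLpNorm h (ENNReal.ofReal p.conjExponent) (volume.restrict (cube i)) ≤
      ENNReal.ofReal N) :
    IsBlock p.conjExponent t.conjExponent (cube i)
      ((cube i).indicator ((cubeWeight p t i * N⁻¹) • h)) := by
  refine ⟨?_, fun x hx => Set.indicator_of_notMem hx _, ?_⟩
  · rw [aestronglyMeasurable_indicator_iff (measurableSet_cube i)]
    exact hm.const_smul _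
  · rw [eLpNorm_indicator_eq_eLpNorm_restrict (measurableSet_cube i), eLpNorm_const_smul,
      enorm_mul, enorm_cubeWeight, conjExponent_inv_sub_inv hp.out ht, mul_assoc]
    refine mul_le_of_le_one_right zero_le ?_
    refine (mul_le_mul_right hn _).trans ?_
    rw [Real.enorm_eq_ofReal (by positivity), ← ENNReal.ofReal_mul (by positivity),
      ENNReal.ofReal_le_one]
    -- An inequality suffices, and it also covers `N = 0`, whose inverse is `0`.
    exact inv_mul_le_one

/-- Every functional on the Bourgain-Morrey space is the pairing with an element of the block space
of at most the same norm. -/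
theorem exists_blockSpace_representation (hn : 1 ≤ n)
    (hX : Function.Surjective (NormedSpace.inclusionInDoubleDual ℝ X))
    (hpt : p < t) (htr : t < r) (L : StrongDual ℝ (MorreySpace n X p t r)) :
    ∃ g : BlockSpace n (StrongDual ℝ X) p.conjExponent t.conjExponent r.conjExponent,
      ‖g‖ ≤ ‖L‖ ∧ ∀ f : MorreySpace n X p t r, L f = ∫ x, g.1 x (f.1 x) := by
  have hp1 := hp.out
  have hr1 := hr.out
  have ht1 : 1 < t := by linarith
  have hpc := Real.HolderConjugate.conjExponent hp1
  have hrc := (Real.HolderConjugate.conjExponent hr1).symm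
  obtain ⟨M, hMn, hM⟩ := MorreySpace.exists_extension L
  let M' := fun i => M ∘L lp.singleContinuousLinearMap ℝ (fun i : CubeIndex n =>
      Lp X (ENNReal.ofReal p) (volume.restrict (cube i))) (ENNReal.ofReal r) i
  have hsum : ∀ s : Finset (CubeIndex n), ∑ i ∈ s, |‖M' i‖| ^ r.conjExponent ≤
      ‖M‖ ^ r.conjExponent := fun s => by
    simp only [abs_norm]
    exact sum_norm_coord_rpow_le M s
  have hl : Summable fun i => |‖M' i‖| ^ r.conjExponent :=
    summable_of_sum_le (fun i => by positivity) hsum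
  choose h hm hnorm hrep using fun i => exists_representation hX hpc (M' i)
  -- The coefficient `‖M' i‖` cancels the normalization, leaving the weighted `h i` on the cube;
  -- where `M' i = 0` the block is zero.
  let b : CubeIndex n → EuclideanSpace ℝ (Fin n) → StrongDual ℝ X := fun i =>
    (cube i).indicator ((cubeWeight p t i * ‖M' i‖⁻¹) • h i)
  have hb : ∀ i, IsBlock p.conjExponent t.conjExponent (cube i) (b i) := fun i =>
    isBlock_indicator ht1 i (hm i) (norm_nonneg _) (by rw [ofReal_norm]; exact hnorm i)
  have hsummable : ∀ᵐ x, Summable fun i => ‖M' i‖ • b i x := by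
    filter_upwards [ae_summable_norm_blocks hn hp1 hpt htr hl hb] with x hx
    exact .of_norm (hx.congr fun i => by rw [norm_smul, Real.norm_eq_abs])
  let g : EuclideanSpace ℝ (Fin n) → StrongDual ℝ X := fun x => ∑' i, ‖M' i‖ • b i x
  have hgm : AEStronglyMeasurable g volume := by
    refine aestronglyMeasurable_of_tendsto_ae (atTop : Filter (Finset (CubeIndex n)))
      (f := fun s x => ∑ i ∈ s, ‖M' i‖ • b i x) (fun s => ?_) ?_
    · exact Finset.aestronglyMeasurable_fun_sum s fun i _ =>
        (hb i).aestronglyMeasurable.fun_const_smul _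
    · filter_upwards [hsummable] with x hx
      exact hx.hasSum
  have hdec : IsDecomposition p.conjExponent t.conjExponent r.conjExponent g (fun i => ‖M' i‖) b :=
    ⟨hl, hb, hsummable.mono fun x hx => hx.hasSum⟩
  have hdec' := hdec.congr (AEEqFun.coeFn_mk g hgm).symm
  refine ⟨⟨AEEqFun.mk g hgm, _, _, hdec'⟩, ?_, fun f => ?_⟩
  · refine (BlockSpace.norm_le _ hdec').trans (le_trans ?_ hMn)
    calc (∑' i, |‖M' i‖| ^ r.conjExponent) ^ (1 / r.conjExponent)
        ≤ (‖M‖ ^ r.conjExponent) ^ (1 / r.conjExponent) := by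
          refine Real.rpow_le_rpow (tsum_nonneg fun i => by positivity)
            (hl.tsum_le_of_sum_le hsum) (one_div_nonneg.2 hrc.pos.le)
      _ = ‖M‖ := by
          rw [← Real.rpow_mul (norm_nonneg _), mul_one_div_cancel hrc.pos.ne', Real.rpow_one]
  · have h1 := (hdec'.pairing hp1 ht1 hr1 (AEEqFun.mk g hgm).aestronglyMeasurable
      f.1.aestronglyMeasurable f.2).2.2
    -- As `r` is finite, the embedded `f` is the sum of its coordinates, so `L f` is a series whose
    -- terms match the blockwise integrals.
    have h2 := (lp.hasSum_single (ENNReal.ofReal_ne_top)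
      (MorreySpace.embedding n p t r X f)).mapL M
    rw [hM] at h2
    refine h2.unique (h1.congr_fun fun i => ?_)
    change M' i (MorreySpace.coord f i) = ∫ x, (‖M' i‖ • b i x) (f.1 x)
    rcases eq_or_ne (M' i) 0 with h0 | h0
    · simp [h0]
    · rw [hrep i, ← integral_indicator (measurableSet_cube i)]
      refine integral_congr_ae ?_
      filter_upwards [(ae_restrict_iff' (measurableSet_cube i)).1
        (MorreySpace.coeFn_coord f i)] with x hx
      by_cases hxQ : x ∈ cube i
      · have hbx : b i x = (cubeWeight p t i * ‖M' i‖⁻¹) • h i x :=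
          Set.indicator_of_mem hxQ _
        rw [Set.indicator_of_mem hxQ, hx hxQ, hbx, map_smul, smul_smul, mul_left_comm,
          mul_inv_cancel₀ (norm_ne_zero_iff.2 h0), mul_one, smul_apply]
      · have hbx : b i x = 0 := Set.indicator_of_notMem hxQ _
        rw [Set.indicator_of_notMem hxQ, hbx, smul_zero, zero_apply]

end Surjectivity

/-! ### Uniqueness of the representing function -/

section Injectivity

variable {n : ℕ} {p t r : ℝ} [hp : Fact (1 < p)] [hr : Fact (1 < r)]
  {X : Type*} [NormedAddCommGroup X] [NormedSpace ℝ X]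

/-- The constant `x` on a measurable subset of a unit cube, as an element of the Bourgain-Morrey
space. -/
noncomputable def MorreySpace.indicatorConst (hn : 1 ≤ n) (hpt : p < t) (htr : t < r)
    (m : Fin n → ℤ) {A : Set (EuclideanSpace ℝ (Fin n))} (hAm : MeasurableSet A)
    (hA : A ⊆ cube ((0 : ℤ), m)) (x : X) : MorreySpace n X p t r :=
  ⟨AEEqFun.mk (A.indicator fun _ => x)
    (stronglyMeasurable_const.indicator hAm).aestronglyMeasurable, by
    change morreyENorm p t r _ < ∞
    rw [morreyENorm_congr (AEEqFun.coeFn_mk _ _)]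
    exact morreyENorm_indicator_const_lt_top hn hp.out hpt htr m hA x⟩

lemma integral_apply_indicatorConst (hn : 1 ≤ n) (hpt : p < t) (htr : t < r)
    (m : Fin n → ℤ) {A : Set (EuclideanSpace ℝ (Fin n))} (hAm : MeasurableSet A)
    (hA : A ⊆ cube ((0 : ℤ), m)) (x : X) (g : EuclideanSpace ℝ (Fin n) → StrongDual ℝ X) :
    (fun w => g w ((MorreySpace.indicatorConst (p := p) (r := r) hn hpt htr m hAm hA x).1 w))
      =ᵐ[volume] A.indicator fun w => g w x := by
  filter_upwards [AEEqFun.coeFn_mk (A.indicator fun _ => x)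
    (stronglyMeasurable_const.indicator hAm).aestronglyMeasurable] with w hw
  rw [MorreySpace.indicatorConst, hw]
  by_cases hwA : w ∈ A <;> simp [hwA]

/-- The Bourgain-Morrey space separates locally integrable functions. -/
theorem ae_eq_zero_of_forall_integral_eq_zero (hn : 1 ≤ n)
    (hX : Function.Surjective (NormedSpace.inclusionInDoubleDual ℝ X))
    (hpt : p < t) (htr : t < r) {g : EuclideanSpace ℝ (Fin n) → StrongDual ℝ X}
    (hg : AEStronglyMeasurable g volume)
    (hint : ∀ f : MorreySpace n X p t r, Integrable fun x => g x (f.1 x))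
    (h : ∀ f : MorreySpace n X p t r, ∫ x, g x (f.1 x) = 0) : g =ᵐ[volume] 0 := by
  obtain ⟨S, hS, hgS⟩ := hg.isSeparable_ae_range
  -- Since `g` is almost separably valued, it may be tested by one functional on `X*` at a time, and
  -- by reflexivity each is evaluation at some `x`.
  refine ae_eq_zero_of_forall_dual_of_isSeparable ℝ hS (fun c => ?_) hgS
  obtain ⟨x, rfl⟩ := hX c
  refine ae_of_forall_unit_cube fun m => ?_
  have hQ := measurableSet_cube (n := n) (0, m)
  have hi : IntegrableOn (fun w => g w x) (cube (0, m)) := by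
    rw [← integrable_indicator_iff hQ]
    exact (hint (MorreySpace.indicatorConst hn hpt htr m hQ subset_rfl x)).congr
      (integral_apply_indicatorConst hn hpt htr m hQ subset_rfl x g)
  refine Integrable.ae_eq_zero_of_forall_setIntegral_eq_zero hi fun s hs _ => ?_
  change ∫ w in s, g w x ∂volume.restrict (cube (0, m)) = 0
  rw [Measure.restrict_restrict hs, ← integral_indicator (hs.inter hQ),
    ← integral_congr_ae (integral_apply_indicatorConst (p := p) (r := r) hn hpt htr m (hs.inter hQ)
      Set.inter_subset_right x g)]
  exact h _

end Injectivity

/-! ### The pairing as a linear map into the dual -/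

section Isomorphism

variable {n : ℕ} {p t r : ℝ} [hp : Fact (1 < p)] [hr : Fact (1 < r)]
  {X : Type*} [NormedAddCommGroup X] [NormedSpace ℝ X]

lemma BlockSpace.integrable_apply (ht : 1 < t)
    (g : BlockSpace n (StrongDual ℝ X) p.conjExponent t.conjExponent r.conjExponent)
    (f : MorreySpace n X p t r) : Integrable fun x => g.1 x (f.1 x) := by
  obtain ⟨l, b, h⟩ := g.2
  exact (h.pairing hp.out ht hr.out g.1.aestronglyMeasurable f.1.aestronglyMeasurable f.2).1

lemma BlockSpace.norm_integral_apply_le (ht : 1 < t)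
    (g : BlockSpace n (StrongDual ℝ X) p.conjExponent t.conjExponent r.conjExponent)
    (f : MorreySpace n X p t r) : ‖∫ x, g.1 x (f.1 x)‖ ≤ ‖g‖ * ‖f‖ := by
  refine le_of_forall_pos_le_add fun δ hδ => ?_
  -- The infimum need not be attained; this near-optimal choice costs at most `δ` after
  -- multiplication by `‖f‖`.
  obtain ⟨l, b, h, hlt⟩ := BlockSpace.exists_lt g (ε := δ / (‖f‖ + 1)) (by positivity)
  refine (h.pairing hp.out ht hr.out g.1.aestronglyMeasurable f.1.aestronglyMeasurable
    f.2).2.1.trans ?_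
  refine (mul_le_mul_of_nonneg_right hlt.le (norm_nonneg f)).trans ?_
  rw [add_mul]
  gcongr
  rw [div_mul_eq_mul_div, div_le_iff₀ (by positivity)]
  nlinarith [norm_nonneg f]

/-- The pairing of the block space with the Bourgain-Morrey space, as a linear map into the dual. -/
noncomputable def BlockSpace.toDual (ht : 1 < t) :
    BlockSpace n (StrongDual ℝ X) p.conjExponent t.conjExponent r.conjExponent →ₗ[ℝ]
      StrongDual ℝ (MorreySpace n X p t r) where
  toFun g := LinearMap.mkContinuous
    { toFun := fun f => ∫ x, g.1 x (f.1 x)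
      map_add' := fun f₁ f₂ => by
        rw [← integral_add (BlockSpace.integrable_apply ht g f₁) (BlockSpace.integrable_apply ht g f₂)]
        refine integral_congr_ae ?_
        filter_upwards [AEEqFun.coeFn_add f₁.1 f₂.1] with x hx
        rw [← map_add]
        exact congrArg (g.1 x) hx
      map_smul' := fun c f => by
        rw [RingHom.id_apply, ← integral_smul]
        refine integral_congr_ae ?_
        filter_upwards [AEEqFun.coeFn_smul c f.1] with x hx
        rw [← map_smul]
        exact congrArg (g.1 x) hx }
    ‖g‖ (BlockSpace.norm_integral_apply_le ht g)
  map_add' g₁ g₂ := by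
    ext f
    change ∫ x, (g₁ + g₂).1 x (f.1 x) = (∫ x, g₁.1 x (f.1 x)) + ∫ x, g₂.1 x (f.1 x)
    rw [← integral_add (BlockSpace.integrable_apply ht g₁ f) (BlockSpace.integrable_apply ht g₂ f)]
    refine integral_congr_ae ?_
    filter_upwards [AEEqFun.coeFn_add g₁.1 g₂.1] with x hx
    exact congrArg (fun y : StrongDual ℝ X => y (f.1 x)) hx
  map_smul' c g := by
    ext f
    change ∫ x, (c • g).1 x (f.1 x) = c • ∫ x, g.1 x (f.1 x)
    rw [← integral_smul]
    refine integral_congr_ae ?_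
    filter_upwards [AEEqFun.coeFn_smul c g.1] with x hx
    exact congrArg (fun y : StrongDual ℝ X => y (f.1 x)) hx

lemma BlockSpace.toDual_apply (ht : 1 < t)
    (g : BlockSpace n (StrongDual ℝ X) p.conjExponent t.conjExponent r.conjExponent)
    (f : MorreySpace n X p t r) :
    BlockSpace.toDual ht g f = ∫ x, g.1 x (f.1 x) := rfl

lemma BlockSpace.toDual_injective (hn : 1 ≤ n)
    (hX : Function.Surjective (NormedSpace.inclusionInDoubleDual ℝ X)) (hpt : p < t) (htr : t < r)
    (ht : 1 < t) :
    Function.Injective (BlockSpace.toDual (n := n) (X := X) (p := p) (t := t) (r := r) ht) := by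
  rw [← LinearMap.ker_eq_bot, LinearMap.ker_eq_bot']
  intro g hg
  refine Subtype.ext (AEEqFun.ext (EventuallyEq.trans ?_ AEEqFun.coeFn_zero.symm))
  refine ae_eq_zero_of_forall_integral_eq_zero (p := p) hn hX hpt htr g.1.aestronglyMeasurable
    (BlockSpace.integrable_apply ht g) fun f => ?_
  rw [← BlockSpace.toDual_apply ht g f, hg, zero_apply]

end Isomorphism

end BourgainMorrey

theorem mainTheorem2 {n : ℕ} (hn : 1 ≤ n)
    {X : Type*} [NormedAddCommGroup X] [NormedSpace ℝ X] [CompleteSpace X]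
    -- `X` is reflexive
    (hX : Function.Surjective (NormedSpace.inclusionInDoubleDual ℝ X))
    {p t r : ℝ} [hp : Fact (1 < p)] [hr : Fact (1 < r)] (hpt : p < t) (htr : t < r) :
    -- the isometric isomorphism `g ↦ L_g`, `L_g(f) = ∫ ⟨f(x), g(x)⟩ dx`
    ∃ Φ : BourgainMorrey.BlockSpace n (StrongDual ℝ X)
          p.conjExponent t.conjExponent r.conjExponent ≃ₗᵢ[ℝ]
        StrongDual ℝ (BourgainMorrey.MorreySpace n X p t r),
      ∀ (g : BourgainMorrey.BlockSpace n (StrongDual ℝ X)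
            p.conjExponent t.conjExponent r.conjExponent)
        (f : BourgainMorrey.MorreySpace n X p t r),
        MeasureTheory.Integrable (fun x => g.1 x (f.1 x)) MeasureTheory.volume ∧
        Φ g f = ∫ x, g.1 x (f.1 x) := by
  have ht : 1 < t := hp.out.trans hpt
  let T := BourgainMorrey.BlockSpace.toDual (n := n) (X := X) (p := p) (t := t) (r := r) ht
  have hinj : Function.Injective T :=
    BourgainMorrey.BlockSpace.toDual_injective hn hX hpt htr ht
  have hrep : ∀ L, ∃ g, ‖g‖ ≤ ‖L‖ ∧ T g = L := fun L => by
    obtain ⟨g, hg, hL⟩ := BourgainMorrey.exists_blockSpace_representation hn hX hpt htr L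
    exact ⟨g, hg, ContinuousLinearMap.ext fun f => (hL f).symm⟩
  refine ⟨⟨LinearEquiv.ofBijective T ⟨hinj, fun L => (hrep L).imp fun _ h => h.2⟩, fun g => ?_⟩,
    fun g f => ⟨BourgainMorrey.BlockSpace.integrable_apply ht g f, rfl⟩⟩
  change ‖T g‖ = ‖g‖
  refine le_antisymm (ContinuousLinearMap.opNorm_le_bound _ (norm_nonneg g)
    (BourgainMorrey.BlockSpace.norm_integral_apply_le ht g)) ?_
  -- Represent `T g` anew by `g'` with `‖g'‖ ≤ ‖T g‖`; injectivity forces `g' = g`, which is the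
  -- lower bound.
  obtain ⟨g', hg', he⟩ := hrep (T g)
  rwa [hinj he] at hg'
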